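/- Let $\mathfrak g$ be a finite-dimensional simple Lie algebra over $\mathbf C$ with a nondegenerate symmetric invariant bilinear form $(\cdot\mid\cdot)$. For $i=1,2$ let $f_i\in\mathfrak g$ be nilpotent, $\chi_i=(f_i\mid\cdot)$, and let $\Gamma^i:\mathfrak g=\bigoplus_{j\in\mathbf Z}\mathfrak g^{(i)}_j$ be a good grading for $f_i$, i.e. a Lie algebra grading such that $f_i\in\mathfrak g^{(i)}_{-2}$ and $\operatorname{ad}(f_i):\mathfrak g^{(i)}_j\to\mathfrak g^{(i)}_{j-2}$ is injective for $j\ge 1$ and surjective for $j\le 1$. Let $q_i\in\mathfrak g$ be the element with $\mathfrak g^{(i)}_j=\{x : [q_i,x]=jx\}$, and assume that $q_1,q_2$ lie in a common Cartan subalgebra $\mathfrak h$. Let $\mathfrak m_i=\mathfrak l_i\oplus\bigoplus_{j\ge 2}\mathfrak g^{(i)}_j$, where $\mathfrak l_i\subseteq\mathfrak g^{(i)}_1$ is Lagrangian for the form $\chi_i([\cdot,\cdot])$. Assume that 1. $\mathfrak m_2=\mathfrak m_1\oplus\mathfrak m_0$, where $\mathfrak m_0$ is an $\mathfrak h$-stable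 Lie subalgebra of $\mathfrak m_2$ and $\mathfrak m_1$ is an ideal of $\mathfrak m_2$; 2. $f_2-f_1\in\mathfrak g^{(1)}_0$ and $\mathfrak m_0\subseteq\mathfrak g^{(1)}_0$; 3. $[q_2-q_1,f_1]=0$. Let $\widehat I_i$ be the left ideal of $\mathcal U(\mathfrak g)$ generated by the $y-\chi_i(y)$, $y\in\mathfrak m_i$, put $Q_i=\mathcal U(\mathfrak g)/\widehat I_i$, and let $\mathcal U(\mathfrak g,f_i)=Q_i^{\operatorname{ad}(\mathfrak m_i)}$ be the finite W-algebra, with product $(X \bmod \widehat I_i)(Y\bmod \widehat I_i)=XY\bmod\widehat I_i$. Let $\mathsf W(\mathfrak g,f_i,\mathfrak m_i)$ be the category of finitely generated $\mathcal U(\mathfrak g)$-modules on which $y-\chi_i(y)$ acts locally nilpotently for every $y\in\mathfrak m_i$, and put $\mathrm{Whi}_i(V)=\{v\in V : yv=\chi_i(y)v\ \ \forall y\in\mathfrak m_i\}$ and $\mathrm{Ind}_i(W)=Q_i\otimes_{\mathcal U(\mathfrak g,f_i)}W$. Then $y\mapsto y\bmod\widehat I_1$ maps $\mathfrak m_0$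 to $\mathcal U(\mathfrak g,f_1)$. Let $\widehat I_0$ be the left ideal of $\mathcal U(\mathfrak g,f_1)$ generated by the $(y-\chi_2(y))\bmod\widehat I_1$, $y\in\mathfrak m_0$, put $Q_0=\mathcal U(\mathfrak g,f_1)/\widehat I_0$ and $\mathcal U_0=Q_0^{\operatorname{ad}(\mathfrak m_0)}$ (an algebra for the product induced by $\mathcal U(\mathfrak g,f_1)$); then $(X\bmod\widehat I_1)\bmod\widehat I_0\mapsto X\bmod\widehat I_2$ is a well-defined algebra isomorphism $\mathcal U_0\cong\mathcal U(\mathfrak g,f_2)$. Let $\mathsf W_0$ be the category of finitely generated $\mathcal U(\mathfrak g,f_1)$-modules on which $y-\chi_2(y)$ acts locally nilpotently for every $y\in\mathfrak m_0$, and put $\mathrm{Whi}_0(V)=\{v\in V : yv=\chi_2(y)v\ \ \forall y\in\mathfrak m_0\}$ and $\mathrm{Ind}_0(W)=Q_0\otimes_{\mathcal U_0}W$, where $\mathcal U_0$-modules are identified with $\mathcal U(\mathfrak g,f_2)$-modules through this isomorphism. Then: (a) $\mathrm{Whi}_0$ and $\mathrm{Ind}_0$ are mutually inverse equivalences between $\mathsf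 W_0$ and the category of finitely generated $\mathcal U(\mathfrak g,f_2)$-modules. (b) $\mathsf W(\mathfrak g,f_2,\mathfrak m_2)\subseteq\mathsf W(\mathfrak g,f_1,\mathfrak m_1)$, and $\mathrm{Whi}_1$ and $\mathrm{Ind}_1$ restrict to mutually inverse equivalences between $\mathsf W(\mathfrak g,f_2,\mathfrak m_2)$ and $\mathsf W_0$. (c) On $\mathsf W(\mathfrak g,f_2,\mathfrak m_2)$ one has $\mathrm{Whi}_2=\mathrm{Whi}_0\circ\mathrm{Whi}_1$, as functors to $\mathcal U(\mathfrak g,f_2)$-modules. -/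

import Mathlib

open CategoryTheory
open scoped TensorProduct

universe u

noncomputable section

namespace Stages

section Reduction

/-- The twisted elements `φ(y) - χ(y)`, `y ∈ L`. -/
def twisted {k A L : Type*} [CommRing k] [Ring A] [Algebra k A] (φ : L → A) (χ : L → k) :
    Set A :=
  Set.range fun y => φ y - algebraMap k A (χ y)

variable {A : Type u} [Ring A]

/-- The left `A`-module `Q = A / A T`. -/
abbrev Q (T : Set A) : Type u := A ⧸ (Ideal.span T : Ideal A)

theorem mul_mem_span {T : Set A} {X : A} (hX : ∀ t ∈ T, ⁅t, X⁆ ∈ Ideal.span T) {a : A}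
    (ha : a ∈ Ideal.span T) : a * X ∈ Ideal.span T := by
  induction ha using Submodule.span_induction with
  | mem t ht =>
    have h := add_mem (hX t ht) ((Ideal.span T).mul_mem_left X (Ideal.subset_span ht))
    rwa [Ring.lie_def, sub_add_cancel] at h
  | zero => simp
  | add x y _ _ hx hy => rw [add_mul]; exact add_mem hx hy
  | smul c x _ hx => rw [smul_eq_mul, mul_assoc]; exact (Ideal.span T).mul_mem_left c hx

/-- All `X ∈ A` whose class in `Q = A / A T` is `ad(T)`-invariant; they form a subalgebra. -/
def normalizer (k : Type*) [CommRing k] [Algebra k A] (T : Set A) : Subalgebra k A where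
  carrier := {X | ∀ t ∈ T, ⁅t, X⁆ ∈ Ideal.span T}
  mul_mem' := by
    intro X Y hX hY t ht
    have h : ⁅t, X * Y⁆ = ⁅t, X⁆ * Y + X * ⁅t, Y⁆ := by
      simp only [Ring.lie_def]; noncomm_ring
    rw [h]
    exact add_mem (mul_mem_span hY (hX t ht)) ((Ideal.span T).mul_mem_left X (hY t ht))
  add_mem' := by
    intro X Y hX hY t ht
    have h : ⁅t, X + Y⁆ = ⁅t, X⁆ + ⁅t, Y⁆ := by
      simp only [Ring.lie_def]; noncomm_ring
    rw [h]
    exact add_mem (hX t ht) (hY t ht)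
  algebraMap_mem' := by
    intro c t _
    rw [Ring.lie_def, Algebra.commutes, sub_self]
    exact zero_mem _

/-- The ideal of those elements of the normalizer whose class in `Q` is zero. -/
def redIdeal (k : Type*) [CommRing k] [Algebra k A] (T : Set A) : Ideal (normalizer k T) :=
  (Ideal.span T).comap (normalizer k T).subtype

instance (k : Type*) [CommRing k] [Algebra k A] (T : Set A) : (redIdeal k T).IsTwoSided :=
  ⟨fun {a} b ha => mul_mem_span (X := b.1) b.2 (a := a.1) ha⟩

/-- The reduction `(A / A T)^{ad T}` of `A`: the classes modulo `A T` of the elements of the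
normalizer, with the product `(X mod A T) (Y mod A T) = X Y mod A T`. -/
def Reduction (k : Type*) [CommRing k] [Algebra k A] (T : Set A) : Type u :=
  normalizer k T ⧸ redIdeal k T

instance (k : Type*) [CommRing k] [Algebra k A] (T : Set A) : Ring (Reduction k T) :=
  inferInstanceAs (Ring (normalizer k T ⧸ redIdeal k T))

instance (k : Type*) [CommRing k] [Algebra k A] (T : Set A) : Algebra k (Reduction k T) :=
  inferInstanceAs (Algebra k (normalizer k T ⧸ redIdeal k T))

variable (k : Type*) [CommRing k] [Algebra k A] (T : Set A)

/-- The class `X mod A T` in the reduction, for `X` in the normalizer. -/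
def cls (X : A) (hX : X ∈ normalizer k T) : Reduction k T :=
  Ideal.Quotient.mk (redIdeal k T) ⟨X, hX⟩

/-- Right multiplication on `Q` by an element of the normalizer. -/
def rightMul (X : normalizer k T) : Q T →ₗ[A] Q T :=
  Submodule.mapQ _ _ (LinearMap.toSpanSingleton A A X.1)
    fun _ ha => mul_mem_span (X := X.1) X.2 ha

theorem rightMul_mk (X : normalizer k T) (a : A) :
    rightMul k T X (Submodule.Quotient.mk a) = Submodule.Quotient.mk (a * X.1) :=
  rfl

/-- The right action of the reduction on `Q`, `(a mod A T) · (X mod A T) = a X mod A T`. It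
commutes with the left action of `A`, so `Q` is a bimodule. -/
def rightAction : Reduction k T →+* (Module.End A (Q T))ᵐᵒᵖ :=
  Ideal.Quotient.lift (redIdeal k T)
    { toFun := fun X => MulOpposite.op (rightMul k T X)
      map_one' := by
        apply MulOpposite.unop_injective
        refine LinearMap.ext fun q => ?_
        obtain ⟨a, rfl⟩ := Submodule.Quotient.mk_surjective _ q
        exact congrArg Submodule.Quotient.mk (mul_one a)
      map_zero' := by
        apply MulOpposite.unop_injective
        refine LinearMap.ext fun q => ?_
        obtain ⟨a, rfl⟩ := Submodule.Quotient.mk_surjective _ q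
        exact congrArg Submodule.Quotient.mk (mul_zero a)
      map_mul' := fun X Y => by
        apply MulOpposite.unop_injective
        refine LinearMap.ext fun q => ?_
        obtain ⟨a, rfl⟩ := Submodule.Quotient.mk_surjective _ q
        exact congrArg Submodule.Quotient.mk (mul_assoc a X.1 Y.1).symm
      map_add' := fun X Y => by
        apply MulOpposite.unop_injective
        refine LinearMap.ext fun q => ?_
        obtain ⟨a, rfl⟩ := Submodule.Quotient.mk_surjective _ q
        exact congrArg Submodule.Quotient.mk (mul_add a X.1 Y.1) }
    (fun X hX => by
      apply MulOpposite.unop_injective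
      refine LinearMap.ext fun q => ?_
      obtain ⟨a, rfl⟩ := Submodule.Quotient.mk_surjective _ q
      exact (Submodule.Quotient.mk_eq_zero _).2 ((Ideal.span T).mul_mem_left a hX))

/-! ### The functor `Whi` -/

/-- The vectors of `V` that are killed by `T`. For `T` the set of `y - χ(y)`, these are the
`v` with `y v = χ(y) v` for all `y`. -/
def whi (V : Type*) [AddCommGroup V] [Module A V] : AddSubgroup V where
  carrier := {v | ∀ t ∈ T, t • v = 0}
  zero_mem' := fun t _ => smul_zero t
  add_mem' := fun {v w} hv hw t ht => by rw [smul_add, hv t ht, hw t ht, add_zero]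
  neg_mem' := fun {v} hv t ht => by rw [smul_neg, hv t ht, neg_zero]

variable {T} in
theorem smul_eq_zero_of_mem_span {V : Type*} [AddCommGroup V] [Module A V] {a : A}
    (ha : a ∈ Ideal.span T) (v : whi T V) : a • (v : V) = 0 := by
  induction ha using Submodule.span_induction with
  | mem t ht => exact v.2 t ht
  | zero => exact zero_smul A _
  | add x y _ _ hx hy => rw [add_smul, hx, hy, add_zero]
  | smul c x _ hx => rw [smul_assoc, hx, smul_zero]

/-- The normalizer acts on the vectors killed by `T`. -/
def whiEnd (V : Type*) [AddCommGroup V] [Module A V] :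
    normalizer k T →+* AddMonoid.End (whi T V) where
  toFun X :=
    { toFun := fun v => ⟨X.1 • (v : V), fun t ht => by
        have h := smul_eq_zero_of_mem_span (X.2 t ht) v
        rwa [Ring.lie_def, sub_smul, mul_smul, mul_smul, v.2 t ht, smul_zero, sub_zero] at h⟩
      map_zero' := Subtype.ext (smul_zero _)
      map_add' := fun v w => Subtype.ext (smul_add _ _ _) }
  map_one' := by ext v; exact one_smul A (v : V)
  map_mul' X Y := by ext v; exact mul_smul X.1 Y.1 (v : V)
  map_zero' := by ext v; exact zero_smul A (v : V)
  map_add' X Y := by ext v; exact add_smul X.1 Y.1 (v : V)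

/-- The reduction acts on the vectors killed by `T` by `(X mod A T) · v = X v`. -/
instance whiModule (V : Type*) [AddCommGroup V] [Module A V] :
    Module (Reduction k T) (whi T V) :=
  Module.compHom (whi T V) (Ideal.Quotient.lift (redIdeal k T) (whiEnd k T V)
    (fun X hX => by
      ext v
      exact smul_eq_zero_of_mem_span (a := X.1) hX v))

theorem cls_smul_coe (V : Type*) [AddCommGroup V] [Module A V] (X : A)
    (hX : X ∈ normalizer k T) (v : whi T V) : ((cls k T X hX • v : whi T V) : V) = X • (v : V) :=
  rfl

/-- A homomorphism of `A`-modules restricts to the vectors killed by `T`. -/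
def whiMap {V W : Type*} [AddCommGroup V] [Module A V] [AddCommGroup W] [Module A W]
    (f : V →ₗ[A] W) : whi T V →ₗ[Reduction k T] whi T W where
  toFun v := ⟨f v, fun t ht => by rw [← map_smul, v.2 t ht, map_zero]⟩
  map_add' v w := Subtype.ext (map_add f _ _)
  map_smul' r v := by
    obtain ⟨X, rfl⟩ := Ideal.Quotient.mk_surjective r
    exact Subtype.ext (map_smul f X.1 (v : V))

/-- The functor `V ↦ Whi(V)` from `A`-modules to modules over the reduction. -/
def Whi : ModuleCat.{u} A ⥤ ModuleCat.{u} (Reduction k T) where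
  obj V := ModuleCat.of _ (whi T V)
  map f := ModuleCat.ofHom (whiMap k T f.hom)

/-! ### The functor `Ind` -/

/-- The relations `(q · r) ⊗ w = q ⊗ (r · w)` in `Q ⊗ W`. -/
def indRel (W : Type*) [AddCommGroup W] [Module (Reduction k T) W] :
    Submodule A (Q T ⊗[ℤ] W) :=
  Submodule.span A {z | ∃ (q : Q T) (r : Reduction k T) (w : W),
    z = ((rightAction k T r).unop q) ⊗ₜ[ℤ] w - q ⊗ₜ[ℤ] (r • w)}

/-- The left `A`-module `Q ⊗ W`, with the tensor product over the reduction. -/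
abbrev ind (W : Type*) [AddCommGroup W] [Module (Reduction k T) W] : Type _ :=
  (Q T ⊗[ℤ] W) ⧸ indRel k T W

/-- The homomorphism `q ⊗ w ↦ q ⊗ f w`. -/
def indMap {V W : Type*} [AddCommGroup V] [Module (Reduction k T) V] [AddCommGroup W]
    [Module (Reduction k T) W] (f : V →ₗ[Reduction k T] W) : ind k T V →ₗ[A] ind k T W :=
  Submodule.mapQ _ _
    (TensorProduct.AlgebraTensorModule.map (LinearMap.id : Q T →ₗ[A] Q T)
      f.toAddMonoidHom.toIntLinearMap)
    (by
      rw [indRel, Submodule.span_le]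
      rintro _ ⟨q, r, w, rfl⟩
      refine Submodule.subset_span ⟨q, r, f w, ?_⟩
      simp)

/-- The functor `W ↦ Q ⊗ W` from modules over the reduction to `A`-modules. -/
def Ind : ModuleCat.{u} (Reduction k T) ⥤ ModuleCat.{u} A where
  obj W := ModuleCat.of _ (ind k T W)
  map f := ModuleCat.ofHom (indMap k T f.hom)
  map_id W := by
    ext : 1
    apply Submodule.linearMap_qext
    apply TensorProduct.AlgebraTensorModule.ext
    intro q w
    rfl
  map_comp f g := by
    ext : 1
    apply Submodule.linearMap_qext
    apply TensorProduct.AlgebraTensorModule.ext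
    intro q w
    rfl

/-! ### Categories of modules -/

/-- Finitely generated `A`-modules on which every element of `T` acts locally nilpotently. -/
def whittaker : ObjectProperty (ModuleCat.{u} A) := fun V =>
  Module.Finite A V ∧ ∀ t ∈ T, ∀ v : V, ∃ n : ℕ, 0 < n ∧ t ^ n • v = 0

/-- Finitely generated modules. -/
def finitelyGenerated (R : Type u) [Ring R] : ObjectProperty (ModuleCat.{u} R) := fun V =>
  Module.Finite R V

end Reduction

/-- The functors `F` and `G` restrict to mutually inverse equivalences between the full
subcategories given by `P` and `P'`. -/
def RestrictToEquivalence {C D : Type*} [Category C] [Category D] (F : C ⥤ D) (G : D ⥤ C)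
    (P : ObjectProperty C) (P' : ObjectProperty D) : Prop :=
  ∃ (hF : ∀ X, P X → P' (F.obj X)) (hG : ∀ Y, P' Y → P (G.obj Y))
    (e : P.FullSubcategory ≌ P'.FullSubcategory),
    e.functor = P'.lift (P.ι ⋙ F) (fun X => hF _ X.property) ∧
    e.inverse = P.lift (P'.ι ⋙ G) (fun Y => hG _ Y.property)

/-! ### Good gradings, good algebras and finite W-algebras -/

section Lie

variable {g : Type u} [LieRing g] [LieAlgebra ℂ g]

/-- `Γ` is a `ℤ`-grading of the Lie algebra `g` that is good for `f`. -/
structure IsGoodGrading (Γ : ℤ → Submodule ℂ g) (f : g) : Prop where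
  isInternal : DirectSum.IsInternal Γ
  lie_mem : ∀ i j, ∀ x ∈ Γ i, ∀ y ∈ Γ j, ⁅x, y⁆ ∈ Γ (i + j)
  mem : f ∈ Γ (-2)
  injective : ∀ j, 1 ≤ j → ∀ x ∈ Γ j, ⁅f, x⁆ = 0 → x = 0
  surjective : ∀ j, j ≤ 1 → ∀ y ∈ Γ (j - 2), ∃ x ∈ Γ j, ⁅f, x⁆ = y

/-- `q` is the element of `g` that defines the grading: `Γ j` is the eigenspace of `ad q` for
the eigenvalue `j`. -/
def IsGradingElement (q : g) (Γ : ℤ → Submodule ℂ g) : Prop :=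
  ∀ (j : ℤ) (x : g), x ∈ Γ j ↔ ⁅q, x⁆ = (j : ℂ) • x

/-- `m = l ⊕ ⨁_{i ≥ 2} Γ i` for a subspace `l` of `Γ 1` which is Lagrangian for the form
`χ([x, y])`, i.e. equal to its own orthogonal in `Γ 1`. -/
def IsGoodAlgebra (Γ : ℤ → Submodule ℂ g) (χ : Module.Dual ℂ g) (m : LieSubalgebra ℂ g) :
    Prop :=
  ∃ l : Submodule ℂ g, (∀ x, x ∈ l ↔ x ∈ Γ 1 ∧ ∀ y ∈ l, χ ⁅x, y⁆ = 0) ∧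
    m.toSubmodule = l ⊔ ⨆ (i : ℤ) (_ : 2 ≤ i), Γ i

/-- The elements `y - χ(y)` of `U(g)`, for `y ∈ m`. -/
def shift (χ : Module.Dual ℂ g) (m : LieSubalgebra ℂ g) :
    Set (UniversalEnvelopingAlgebra ℂ g) :=
  twisted (fun y : m => UniversalEnvelopingAlgebra.ι ℂ (y : g)) (fun y : m => χ (y : g))

/-- The finite W-algebra `(U(g) / Î)^{ad m}`, where `Î` is the left ideal generated by the
`y - χ(y)`, `y ∈ m`. -/
abbrev FiniteW (χ : Module.Dual ℂ g) (m : LieSubalgebra ℂ g) : Type u :=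
  Reduction ℂ (shift χ m)

/-- The elements `y - χ'(y) mod Î` of the finite W-algebra of `(χ, m)`, for `y ∈ m₀`. -/
def shift₀ (χ : Module.Dual ℂ g) (m : LieSubalgebra ℂ g) (χ' : Module.Dual ℂ g)
    (m₀ : LieSubalgebra ℂ g)
    (h : ∀ y ∈ m₀, UniversalEnvelopingAlgebra.ι ℂ y ∈ normalizer ℂ (shift χ m)) :
    Set (FiniteW χ m) :=
  twisted (fun y : m₀ => cls ℂ (shift χ m) (UniversalEnvelopingAlgebra.ι ℂ (y : g)) (h y y.2))
    (fun y : m₀ => χ' (y : g))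

/-- The category `W(g, f, m)` of finitely generated `U(g)`-modules on which the `y - χ(y)`,
`y ∈ m`, act locally nilpotently. -/
abbrev WhittakerModules (χ : Module.Dual ℂ g) (m : LieSubalgebra ℂ g) :
    ObjectProperty (ModuleCat.{u} (UniversalEnvelopingAlgebra ℂ g)) :=
  whittaker (shift χ m)

end Lie

/-! ### The second stage, with the reduction `U₀` of `A` identified with `R` -/

section SecondStage

variable {A R : Type u} [Ring A] [Algebra ℂ A] [Ring R] [Algebra ℂ R] (T : Set A)
  (Ψ : Reduction ℂ T ≃ₐ[ℂ] R)

/-- `Whi`, seen as a functor to `R`-modules through `Ψ`. -/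
def WhiVia : ModuleCat.{u} A ⥤ ModuleCat.{u} R :=
  Whi ℂ T ⋙ ModuleCat.restrictScalars (Ψ.symm : R →+* Reduction ℂ T)

/-- `Ind`, seen as a functor from `R`-modules through `Ψ`. -/
def IndVia : ModuleCat.{u} R ⥤ ModuleCat.{u} A :=
  ModuleCat.restrictScalars (Ψ : Reduction ℂ T →+* R) ⋙ Ind ℂ T

end SecondStage

end Stages

end

/-! Everything rests on Skryabin's equivalence, in a form that applies to both W-algebras and to the
second stage. For a subset `T` of a ring `A`, call `Q = A / A T` a projective generator if `T` acts
locally nilpotently on `Q`, if vectors killed by `T` ("invariants") lift along quotients of locally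
nilpotent modules, so that `Whi = Hom_A(Q, -)` is exact there, and if such a module without nonzero
invariants is zero (`IsProjectiveGenerator`). A Morita argument then makes `Ind` and `Whi` inverse
equivalences with the modules over the reduction, compatible with finite generation. Its core is
`mem_of_coe_mem_span`: `A N ∩ Whi(V) = N` for every submodule `N` of `Whi(V)`.

For the shifted elements of a good algebra `m` the three properties hold
(`GoodData.isProjectiveGenerator`). Elements of `m` have positive degree, so they are ad-nilpotent,
and Engel's theorem gives invariants. Lifting is the vanishing of a first cohomology group: as `ad
f` is injective on `m`, a homogeneous basis `x i` has dual elements `z i` with `χ([x i, z j]) =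
δ_ij`. On a filtration of Kazhdan type, `x i - χ(x i)` and `z i` satisfy the relations of `∂/∂z_i`
and `z_i` up to lower degree, and a formal Poincaré lemma corrects a vector degree by degree
(`exists_sub_eq_zero`).

For the two stages, `f₂ - f₁` of degree `0` gives `χ₁ = χ₂` on `m₁`. Hence each element of `T₂` is a
sum of one from `T₁` and one from the shifted `m₀`, which normalizes `T₁`. So `Whi₂ = Whi₀ ∘ Whi₁`,
and the core lemma gives `Whi₁(Q₂) = Q₀`; taking invariants yields the isomorphism of algebras. The
generator property passes from `T₂` to `T₀` through the first equivalence (`gen₀`). -/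

noncomputable section

namespace Stages

/-! ### Locally nilpotent action -/

section LocallyNilpotent

variable {A : Type*} [Ring A]

/-- The vectors of `V` that are killed by a power of `t`. -/
def nilVectors (t : A) (V : Type*) [AddCommGroup V] [Module A V] : AddSubgroup V where
  carrier := {v | ∃ n : ℕ, t ^ n • v = 0}
  zero_mem' := ⟨0, smul_zero _⟩
  add_mem' := by
    rintro v w ⟨n, hn⟩ ⟨m, hm⟩
    refine ⟨n + m, ?_⟩
    rw [smul_add, pow_add, mul_smul _ _ w, hm, smul_zero, add_zero, ← pow_add, add_comm, pow_add,
      mul_smul, hn, smul_zero]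
  neg_mem' := by
    rintro v ⟨n, hn⟩
    exact ⟨n, by rw [smul_neg, hn, neg_zero]⟩

/-- Every element of `T` acts locally nilpotently on `V`. -/
def LocNil (T : Set A) (V : Type*) [AddCommGroup V] [Module A V] : Prop :=
  ∀ t ∈ T, ∀ v : V, v ∈ nilVectors t V

variable {T : Set A} {V W : Type*} [AddCommGroup V] [Module A V] [AddCommGroup W] [Module A W]

theorem map_mem_nilVectors (f : V →ₗ[A] W) {t : A} {v : V} (hv : v ∈ nilVectors t V) :
    f v ∈ nilVectors t W := by
  obtain ⟨n, hn⟩ := hv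
  exact ⟨n, by rw [← map_smul, hn, map_zero]⟩

theorem LocNil.of_injective (hW : LocNil T W) (f : V →ₗ[A] W) (hf : Function.Injective f) :
    LocNil T V := by
  intro t ht v
  obtain ⟨n, hn⟩ := hW t ht (f v)
  exact ⟨n, hf (by rw [map_smul, hn, map_zero])⟩

theorem LocNil.of_surjective (hV : LocNil T V) (f : V →ₗ[A] W) (hf : Function.Surjective f) :
    LocNil T W := by
  intro t ht w
  obtain ⟨v, rfl⟩ := hf w
  exact map_mem_nilVectors f (hV t ht v)

theorem LocNil.finsupp (hV : LocNil T V) (I : Type*) : LocNil T (I →₀ V) := by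
  intro t ht x
  induction x using Finsupp.induction_linear with
  | zero => exact zero_mem _
  | add x y hx hy => exact add_mem hx hy
  | single i v => exact map_mem_nilVectors (Finsupp.lsingle i : V →ₗ[A] I →₀ V) (hV t ht v)

theorem LocNil.mono {T' : Set A} (hV : LocNil T V) (h : T' ⊆ T) : LocNil T' V :=
  fun t ht => hV t (h ht)

/-- If `ad t` kills `a` after `m` steps and `t` kills `v` after `n` steps, then `t` kills `a v`
after `n + m` steps. -/
theorem pow_smul_smul_eq_zero {t : A} (m : ℕ) : ∀ (n : ℕ) (a : A) (v : V),
    (fun b => ⁅t, b⁆)^[m] a = 0 → t ^ n • v = 0 → t ^ (n + m) • a • v = 0 := by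
  induction m with
  | zero =>
    intro n a v ha _
    rw [Function.iterate_zero, id] at ha
    rw [ha, zero_smul, smul_zero]
  | succ m ihm =>
    intro n
    induction n with
    | zero =>
      intro a v _ hv
      rw [pow_zero, one_smul] at hv
      rw [hv, smul_zero, smul_zero]
    | succ n ihn =>
      intro a v ha hv
      have h₁ := ihm (n + 1) ⁅t, a⁆ v ha hv
      have h₂ := ihn a (t • v) ha (by rw [← mul_smul, ← pow_succ]; exact hv)
      have e : t • a • v = ⁅t, a⁆ • v + a • t • v := by
        rw [Ring.lie_def, sub_smul, mul_smul, mul_smul, sub_add_cancel]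
      rw [show n + 1 + (m + 1) = (n + 1 + m) + 1 by ring, pow_succ, mul_smul, e, smul_add, h₁,
        zero_add, show n + 1 + m = n + (m + 1) by ring, h₂]

end LocallyNilpotent

/-! ### Morita theory: locally nilpotent modules and modules over the reduction. -/

section Morita

variable {A : Type u} [Ring A] {k : Type*} [CommRing k] [Algebra k A] {T : Set A}

-- `t X` and `⁅t, X⁆` differ by `X t`, which lies in the left ideal.
variable (k) in
theorem mk_mem_whi_iff {X : A} :
    (Submodule.Quotient.mk X : Q T) ∈ whi T (Q T) ↔ X ∈ normalizer k T := by
  refine forall₂_congr fun t ht => ?_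
  rw [← Submodule.Quotient.mk_smul, Submodule.Quotient.mk_eq_zero, smul_eq_mul, Ring.lie_def]
  exact (Submodule.sub_mem_iff_left _
    ((Ideal.span T).mul_mem_left X (Ideal.subset_span ht))).symm

theorem one_mem_whi : (Submodule.Quotient.mk 1 : Q T) ∈ whi T (Q T) :=
  -- The condition defining the normalizer does not involve the base ring, so `ℤ` serves for every
  -- `A`.
  (mk_mem_whi_iff ℤ).2 (one_mem _)

theorem cls_surjective (r : Reduction k T) : ∃ X hX, cls k T X hX = r := by
  obtain ⟨X, rfl⟩ := Ideal.Quotient.mk_surjective r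
  exact ⟨X.1, X.2, rfl⟩

theorem cls_eq_zero_iff {X : A} {hX : X ∈ normalizer k T} :
    cls k T X hX = 0 ↔ X ∈ Ideal.span T :=
  Ideal.Quotient.eq_zero_iff_mem

/-- The homomorphism `Q → V`, `a mod A T ↦ a v`, for a vector `v` killed by `T`. -/
def whiHom {V : Type*} [AddCommGroup V] [Module A V] (v : whi T V) : Q T →ₗ[A] V :=
  Submodule.liftQ _ (LinearMap.toSpanSingleton A V (v : V))
    fun _ ha => smul_eq_zero_of_mem_span ha v

theorem whiHom_mk {V : Type*} [AddCommGroup V] [Module A V] (v : whi T V) (a : A) :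
    whiHom v (Submodule.Quotient.mk a) = a • (v : V) :=
  rfl

variable {W : Type*} [AddCommGroup W] [Module (Reduction k T) W]

/-- The homomorphism `Q ⊗ W → V`, `a ⊗ w ↦ a h(w)`. -/
def indLift {V : Type*} [AddCommGroup V] [Module A V]
    (h : W →ₗ[Reduction k T] whi T V) : ind k T W →ₗ[A] V :=
  Submodule.liftQ _
    (TensorProduct.AlgebraTensorModule.lift
      { toFun := fun q =>
          AddMonoidHom.toIntLinearMap
            { toFun := fun w => whiHom (h w) q
              map_zero' := by
                obtain ⟨a, rfl⟩ := Submodule.Quotient.mk_surjective _ q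
                rw [whiHom_mk, map_zero]
                exact smul_zero a
              map_add' := fun w w' => by
                obtain ⟨a, rfl⟩ := Submodule.Quotient.mk_surjective _ q
                rw [whiHom_mk, map_add]
                exact smul_add a _ _ }
        map_add' := fun q q' => by ext w; exact map_add (whiHom (h w)) q q'
        map_smul' := fun a q => by ext w; exact map_smul (whiHom (h w)) a q })
    (by
      rw [indRel, Submodule.span_le]
      rintro _ ⟨q, r, w, rfl⟩
      obtain ⟨a, rfl⟩ := Submodule.Quotient.mk_surjective _ q
      obtain ⟨X, hX, rfl⟩ := cls_surjective r
      refine LinearMap.mem_ker.2 ?_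
      rw [map_sub, sub_eq_zero]
      change (a * X) • (h w : V) = a • (h (cls k T X hX • w) : V)
      rw [map_smul, cls_smul_coe, mul_smul])

variable (k T W) in
/-- The unit `w ↦ 1 ⊗ w`. -/
def indUnit : W →ₗ[Reduction k T] whi T (ind k T W) where
  toFun w := ⟨Submodule.Quotient.mk ((Submodule.Quotient.mk 1 : Q T) ⊗ₜ[ℤ] w), fun t ht => by
    rw [← Submodule.Quotient.mk_smul, TensorProduct.smul_tmul', one_mem_whi t ht,
      TensorProduct.zero_tmul]
    rfl⟩
  map_add' w w' := Subtype.ext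
    (congrArg Submodule.Quotient.mk (TensorProduct.tmul_add (Submodule.Quotient.mk 1 : Q T) w w'))
  map_smul' r w := by
    obtain ⟨X, hX, rfl⟩ := cls_surjective r
    have h : (Submodule.Quotient.mk ((Submodule.Quotient.mk (1 * X) : Q T) ⊗ₜ[ℤ] w) :
        ind k T W) = Submodule.Quotient.mk ((Submodule.Quotient.mk 1 : Q T) ⊗ₜ[ℤ]
          (cls k T X hX • w)) :=
      (Submodule.Quotient.eq _).2 (Submodule.subset_span
        ⟨Submodule.Quotient.mk 1, cls k T X hX, w, rfl⟩)
    refine Subtype.ext (h.symm.trans ?_)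
    change _ = X • (Submodule.Quotient.mk ((Submodule.Quotient.mk 1 : Q T) ⊗ₜ[ℤ] w) : ind k T W)
    rw [← Submodule.Quotient.mk_smul, TensorProduct.smul_tmul', ← Submodule.Quotient.mk_smul,
      smul_eq_mul, mul_one, one_mul]

theorem smul_indUnit (a : A) (w : W) : a • (indUnit k T W w : ind k T W) =
    Submodule.Quotient.mk ((Submodule.Quotient.mk a : Q T) ⊗ₜ[ℤ] w) := by
  change a • (Submodule.Quotient.mk ((Submodule.Quotient.mk 1 : Q T) ⊗ₜ[ℤ] w) : ind k T W) = _
  rw [← Submodule.Quotient.mk_smul, TensorProduct.smul_tmul', ← Submodule.Quotient.mk_smul,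
      smul_eq_mul, mul_one]

theorem indLift_indUnit {V : Type*} [AddCommGroup V] [Module A V]
    (h : W →ₗ[Reduction k T] whi T V) (w : W) :
    indLift h (indUnit k T W w : ind k T W) = (h w : V) :=
  one_smul A _

/-- To prove a property of the vectors of `Q ⊗ W`, it is enough to do so for `a (1 ⊗ w)`. -/
theorem ind_induction {p : ind k T W → Prop} (zero : p 0)
    (smul : ∀ (a : A) (w : W), p (a • (indUnit k T W w : ind k T W)))
    (add : ∀ x y, p x → p y → p (x + y)) (x : ind k T W) : p x := by
  obtain ⟨z, rfl⟩ := Submodule.Quotient.mk_surjective _ x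
  induction z using TensorProduct.induction_on with
  | zero => exact zero
  | tmul q w =>
    obtain ⟨a, rfl⟩ := Submodule.Quotient.mk_surjective _ q
    rw [← smul_indUnit]
    exact smul a w
  | add x y hx hy => exact add _ _ hx hy

theorem ind_hom_ext {V : Type*} [AddCommGroup V] [Module A V] {f g : ind k T W →ₗ[A] V}
    (h : ∀ w, f (indUnit k T W w : ind k T W) = g (indUnit k T W w : ind k T W)) : f = g := by
  refine LinearMap.ext fun x => ?_
  induction x using ind_induction with
  | zero => simp
  | smul a w => rw [map_smul, map_smul, h]
  | add x y hx hy => rw [map_add, map_add, hx, hy]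

variable (k T W) in
theorem ind_locNil (hQ : LocNil T (Q T)) : LocNil T (ind k T W) := by
  intro t ht x
  induction x using ind_induction with
  | zero => exact zero_mem _
  | smul a w =>
    exact map_mem_nilVectors (whiHom (indUnit k T W w)) (hQ t ht (Submodule.Quotient.mk a))
  | add x y hx hy => exact add_mem hx hy

variable (k T W) in
theorem span_indUnit : Submodule.span A
    (Set.range fun w => (indUnit k T W w : ind k T W)) = ⊤ := by
  rw [eq_top_iff]
  rintro x -
  induction x using ind_induction with
  | zero => exact zero_mem _
  | smul a w => exact Submodule.smul_mem _ _ (Submodule.subset_span ⟨w, rfl⟩)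
  | add x y hx hy => exact add_mem hx hy

variable (k T W) in
theorem ind_finite [Module.Finite (Reduction k T) W] : Module.Finite A (ind k T W) := by
  obtain ⟨s, hs⟩ := ‹Module.Finite (Reduction k T) W›.fg_top
  refine ⟨Submodule.fg_def.2
    ⟨(fun w => (indUnit k T W w : ind k T W)) '' s, s.finite_toSet.image _, ?_⟩⟩
  rw [← span_indUnit k T W]
  refine le_antisymm (Submodule.span_mono (Set.image_subset_range _ _)) (Submodule.span_le.2 ?_)
  rintro _ ⟨w, rfl⟩
  have hw : w ∈ Submodule.span (Reduction k T) (s : Set W) := hs ▸ Submodule.mem_top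
  induction hw using Submodule.span_induction with
  | mem w hw => exact Submodule.subset_span ⟨w, hw, rfl⟩
  | zero =>
    change ((indUnit k T W 0 : whi T (ind k T W)) : ind k T W) ∈ _
    rw [map_zero]; exact zero_mem _
  | add x y _ _ hx hy =>
    change ((indUnit k T W (x + y) : whi T (ind k T W)) : ind k T W) ∈ _
    rw [map_add]; exact add_mem hx hy
  | smul r x _ hx =>
    obtain ⟨X, hX, rfl⟩ := cls_surjective r
    change ((indUnit k T W (cls k T X hX • x) : whi T (ind k T W)) : ind k T W) ∈ _
    rw [map_smul, cls_smul_coe]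
    exact Submodule.smul_mem _ _ hx

/-- `Q` is a projective generator, with respect to `Whi`, of the category of the modules on
which `T` acts locally nilpotently. -/
structure IsProjectiveGenerator (T : Set A) : Prop where
  locNil : LocNil T (Q T)
  exists_sub_mem : ∀ (V : Type u) [AddCommGroup V] [Module A V], LocNil T V →
    ∀ (K : Submodule A V) (v : V), (∀ t ∈ T, t • v ∈ K) → ∃ w ∈ K, v - w ∈ whi T V
  eq_zero : ∀ (V : Type u) [AddCommGroup V] [Module A V], LocNil T V →
    (∀ v ∈ whi T V, v = 0) → ∀ v : V, v = 0

namespace IsProjectiveGenerator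

variable {V : Type u} [AddCommGroup V] [Module A V]

/-- A sum of copies of `Q`, one for each element of `N`, maps onto `A N`. An invariant vector of `A
N` lifts to an invariant of the sum; its coordinates are classes of elements of the normalizer, so
its image is a combination of elements of `N` over the reduction. -/
theorem mem_of_coe_mem_span (hT : IsProjectiveGenerator T) (N : Submodule (Reduction k T) (whi T V))
    (v : whi T V) (hv : (v : V) ∈ Submodule.span A ((↑) '' (N : Set (whi T V)) : Set V)) :
    v ∈ N := by
  let π : (N →₀ Q T) →ₗ[A] V := Finsupp.lsum ℕ fun n => whiHom n.1
  have hπ (n : N) (q : Q T) : π (Finsupp.single n q) = whiHom n.1 q := by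
    simp [π]
  have hle : Submodule.span A ((↑) '' (N : Set (whi T V)) : Set V) ≤ LinearMap.range π := by
    rw [Submodule.span_le]
    rintro _ ⟨n, hn, rfl⟩
    exact ⟨Finsupp.single ⟨n, hn⟩ (Submodule.Quotient.mk 1), by
      rw [hπ, whiHom_mk, one_smul]⟩
  obtain ⟨x, hx⟩ := hle hv
  obtain ⟨w, hw, hxw⟩ := hT.exists_sub_mem (N →₀ Q T) (hT.locNil.finsupp N) (LinearMap.ker π) x
    fun t ht => by rw [LinearMap.mem_ker, map_smul, hx, v.2 t ht]
  have hy : π (x - w) = v := by rw [map_sub, hx, LinearMap.mem_ker.1 hw, sub_zero]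
  have hmem : π (x - w) ∈ N.toAddSubgroup.map (whi T V).subtype := by
    have : π (x - w) = (x - w).sum fun n q => whiHom n.1 q := rfl
    rw [this]
    refine sum_mem fun n _ => ?_
    obtain ⟨X, hX⟩ := Submodule.Quotient.mk_surjective _ ((x - w) n)
    have hXn : X ∈ normalizer k T := by
      rw [← mk_mem_whi_iff k, hX]
      exact fun t ht => by rw [← Finsupp.smul_apply, hxw t ht]; rfl
    exact ⟨cls k T X hXn • n.1, N.smul_mem _ n.2, by rw [← hX]; rfl⟩
  rw [hy] at hmem
  obtain ⟨n, hn, hnv⟩ := hmem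
  rwa [← Subtype.ext hnv]

variable {W : Type u} [AddCommGroup W] [Module (Reduction k T) W]

/-- The vectors `1 ⊗ w` generate `Q ⊗ W` over `A`, so `mem_of_coe_mem_span` applies to their set. -/
theorem indUnit_surjective (hT : IsProjectiveGenerator T) :
    Function.Surjective (indUnit k T W) := by
  intro v
  refine hT.mem_of_coe_mem_span (LinearMap.range (indUnit k T W)) v ?_
  have h := span_indUnit k T W
  rw [Set.range_comp' (fun v : whi T (ind k T W) => (v : ind k T W)),
    ← LinearMap.coe_range] at h
  rw [h]
  exact Submodule.mem_top

/-- Present `W` as a free module modulo `ker c`. The module `Q^(W) / A j(ker c)` receives a map `h`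
from `W` into its invariants, and `h` factors through `Q ⊗ W`. If `1 ⊗ w = 0`, then `h w = 0`, so
the basis vector of `w` lies in `A j(ker c)`, hence in `j(ker c)` by `mem_of_coe_mem_span`, and `w =
0`. -/
theorem indUnit_injective (hT : IsProjectiveGenerator T) :
    Function.Injective (indUnit k T W) := by
  rw [injective_iff_map_eq_zero]
  intro w hw
  let e (w : W) : whi T (W →₀ Q T) := ⟨Finsupp.single w (Submodule.Quotient.mk 1), fun t ht => by
    rw [Finsupp.smul_single, one_mem_whi t ht, Finsupp.single_zero]⟩
  let c : (W →₀ Reduction k T) →ₗ[Reduction k T] W := Finsupp.linearCombination _ id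
  let j : (W →₀ Reduction k T) →ₗ[Reduction k T] whi T (W →₀ Q T) :=
    Finsupp.linearCombination _ e
  have hc : Function.Surjective c := Finsupp.linearCombination_id_surjective _ _
  have hj_apply (f : W →₀ Reduction k T) (w : W) : (j f : W →₀ Q T) w =
      ((f w • ⟨Submodule.Quotient.mk 1, one_mem_whi⟩ : whi T (Q T)) : Q T) := by
    induction f using Finsupp.induction_linear with
    | zero => rw [map_zero, Finsupp.zero_apply, zero_smul]; rfl
    | add f g hf hg =>
      rw [map_add, Finsupp.add_apply, add_smul]
      change (j f : W →₀ Q T) w + (j g : W →₀ Q T) w = _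
      rw [hf, hg]
      rfl
    | single w' r =>
      obtain ⟨X, hX, rfl⟩ := cls_surjective r
      rw [Finsupp.linearCombination_single, cls_smul_coe, Finsupp.smul_apply]
      by_cases h : w' = w
      · subst h
        rw [Finsupp.single_eq_same, Finsupp.single_eq_same, cls_smul_coe]
      · rw [Finsupp.single_eq_of_ne' h, Finsupp.single_eq_of_ne' h, smul_zero, zero_smul]
        rfl
  have hj : Function.Injective j := by
    rw [injective_iff_map_eq_zero]
    intro f hf
    ext w
    obtain ⟨X, hX, hXf⟩ := cls_surjective (f w)
    have h := hj_apply f w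
    rw [hf, ← hXf, cls_smul_coe, ← Submodule.Quotient.mk_smul, smul_eq_mul, mul_one] at h
    rw [← hXf, Finsupp.zero_apply, cls_eq_zero_iff]
    exact (Submodule.Quotient.mk_eq_zero _).1 h.symm
  let N : Submodule (Reduction k T) (whi T (W →₀ Q T)) := (LinearMap.ker c).map j
  let M : Submodule A (W →₀ Q T) :=
    Submodule.span A ((↑) '' (N : Set (whi T (W →₀ Q T))) : Set (W →₀ Q T))
  let p := whiMap k T M.mkQ ∘ₗ j
  have hp : LinearMap.ker c ≤ LinearMap.ker p := by
    intro f hf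
    refine Subtype.ext ((Submodule.Quotient.mk_eq_zero M).2 ?_)
    exact Submodule.subset_span ⟨j f, ⟨f, hf, rfl⟩, rfl⟩
  let h : W →ₗ[Reduction k T] whi T ((W →₀ Q T) ⧸ M) :=
    (LinearMap.ker c).liftQ p hp ∘ₗ (c.quotKerEquivOfSurjective hc).symm.toLinearMap
  have hh (f : W →₀ Reduction k T) : h (c f) = p f := by
    have : (c.quotKerEquivOfSurjective hc).symm (c f) = Submodule.Quotient.mk f := by
      rw [LinearEquiv.symm_apply_eq]; rfl
    change (LinearMap.ker c).liftQ p hp ((c.quotKerEquivOfSurjective hc).symm (c f)) = _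
    rw [this]
    rfl
  have hcw : c (Finsupp.single w 1) = w := by
    simp [c]
  have h0 : p (Finsupp.single w 1) = 0 := by
    rw [← hh, hcw]
    refine Subtype.ext ?_
    rw [← indLift_indUnit h w, hw]
    exact map_zero (indLift h)
  have hmem : (j (Finsupp.single w 1) : W →₀ Q T) ∈ M :=
    (Submodule.Quotient.mk_eq_zero M).1 (congrArg Subtype.val h0)
  obtain ⟨f, hf, hfw⟩ := hT.mem_of_coe_mem_span N _ hmem
  rw [← hcw, ← hj hfw]
  exact hf

theorem indUnit_bijective (hT : IsProjectiveGenerator T) :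
    Function.Bijective (indUnit k T W) :=
  ⟨hT.indUnit_injective, hT.indUnit_surjective⟩

/-- Invariants of `V / A Whi(V)` lift to invariants of `V`, so this quotient has none but zero and
vanishes. -/
theorem span_whi_eq_top (hT : IsProjectiveGenerator T) (hV : LocNil T V) :
    Submodule.span A (whi T V : Set V) = ⊤ := by
  set M := Submodule.span A (whi T V : Set V)
  rw [eq_top_iff]
  rintro v -
  rw [← Submodule.Quotient.mk_eq_zero]
  refine hT.eq_zero (V ⧸ M) (hV.of_surjective M.mkQ M.mkQ_surjective) ?_ _
  intro x hx
  obtain ⟨x, rfl⟩ := Submodule.Quotient.mk_surjective _ x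
  obtain ⟨w, hw, hxw⟩ := hT.exists_sub_mem V hV M x fun t ht =>
    (Submodule.Quotient.mk_eq_zero M).1 (hx t ht)
  rw [Submodule.Quotient.mk_eq_zero]
  simpa using add_mem (Submodule.subset_span hxw : x - w ∈ M) hw

theorem indLift_surjective (hT : IsProjectiveGenerator T) (hV : LocNil T V)
    {h : W →ₗ[Reduction k T] whi T V} (hh : Function.Surjective h) :
    Function.Surjective (indLift h) := by
  rw [← LinearMap.range_eq_top, eq_top_iff, ← hT.span_whi_eq_top hV, Submodule.span_le]
  intro v hv
  obtain ⟨w, hw⟩ := hh ⟨v, hv⟩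
  exact ⟨_, (indLift_indUnit h w).trans (congrArg Subtype.val hw)⟩

/-- The kernel is locally nilpotent, and its invariants are of the form `1 ⊗ w` with `h w = 0`,
hence zero. -/
theorem indLift_injective (hT : IsProjectiveGenerator T)
    {h : W →ₗ[Reduction k T] whi T V} (hh : Function.Injective h) :
    Function.Injective (indLift h) := by
  rw [injective_iff_map_eq_zero]
  intro x hx
  have := hT.eq_zero (LinearMap.ker (indLift h))
    ((ind_locNil k T W hT.locNil).of_injective _ (Submodule.subtype_injective _))
    (fun u hu => by
      obtain ⟨w, hw⟩ := hT.indUnit_surjective (k := k) (W := W)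
        ⟨u.1, fun t ht => congrArg Subtype.val (hu t ht)⟩
      have h₀ : (h w : V) = 0 := by
        rw [← LinearMap.mem_ker.1 u.2, ← congrArg Subtype.val hw]
        exact (indLift_indUnit h w).symm
      have h₁ : w = 0 := (injective_iff_map_eq_zero h).1 hh w (Subtype.ext h₀)
      rw [h₁, map_zero] at hw
      exact Subtype.ext (congrArg Subtype.val hw).symm) ⟨x, hx⟩
  exact congrArg Subtype.val this

theorem indLift_bijective (hT : IsProjectiveGenerator T) (hV : LocNil T V)
    {h : W →ₗ[Reduction k T] whi T V} (hh : Function.Bijective h) :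
    Function.Bijective (indLift h) :=
  ⟨hT.indLift_injective hh.1, hT.indLift_surjective hV hh.2⟩

-- Finitely many invariants generate `V`; by `mem_of_coe_mem_span` they generate `Whi(V)` over the
-- reduction.
variable (k) in
theorem whi_finite (hT : IsProjectiveGenerator T) (hV : LocNil T V) [hf : Module.Finite A V] :
    Module.Finite (Reduction k T) (whi T V) := by
  have h := hf.fg_top
  rw [← hT.span_whi_eq_top hV, Submodule.fg_span_iff_fg_span_finset_subset] at h
  obtain ⟨s, hs, hspan⟩ := h
  rw [hT.span_whi_eq_top hV] at hspan
  refine ⟨Submodule.fg_def.2 ⟨Subtype.val ⁻¹' s,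
    s.finite_toSet.preimage Subtype.val_injective.injOn, ?_⟩⟩
  rw [eq_top_iff]
  rintro v -
  refine hT.mem_of_coe_mem_span _ v ?_
  set N := Submodule.span (Reduction k T) (Subtype.val ⁻¹' (s : Set V) : Set (whi T V)) with hN
  have hle : Submodule.span A (s : Set V) ≤
      Submodule.span A ((↑) '' (N : Set (whi T V)) : Set V) := by
    refine Submodule.span_mono fun x hx => ⟨⟨x, hs hx⟩, ?_, rfl⟩
    rw [hN]
    exact Submodule.subset_span hx
  rw [← hspan] at hle
  exact hle Submodule.mem_top

end IsProjectiveGenerator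

end Morita

/-! ### Restriction of functors to equivalences -/

/-- `Equivalence.mk` corrects the unit itself, so no triangle identity between `η` and `ε` is
required. -/
theorem RestrictToEquivalence.of_natTrans {C D : Type*} [Category C] [Category D] {F : C ⥤ D}
    {G : D ⥤ C} {P : ObjectProperty C} {P' : ObjectProperty D}
    (hF : ∀ X, P X → P' (F.obj X)) (hG : ∀ Y, P' Y → P (G.obj Y))
    (η : 𝟭 D ⟶ G ⋙ F) (ε : F ⋙ G ⟶ 𝟭 C)
    (hη : ∀ Y, P' Y → IsIso (η.app Y)) (hε : ∀ X, P X → IsIso (ε.app X)) :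
    RestrictToEquivalence F G P P' := by
  let F' := P'.lift (P.ι ⋙ F) fun X => hF _ X.property
  let G' := P.lift (P'.ι ⋙ G) fun Y => hG _ Y.property
  refine ⟨hF, hG, CategoryTheory.Equivalence.mk F' G' ?_ ?_, rfl, rfl⟩
  · refine (NatIso.ofComponents (F := F' ⋙ G') (G := 𝟭 _) (fun X =>
      haveI := hε X.obj X.property
      P.isoMk (asIso (ε.app X.obj))) fun {X Y} f => ?_).symm
    exact P.hom_ext (ε.naturality f.hom)
  · refine (NatIso.ofComponents (F := 𝟭 _) (G := G' ⋙ F') (fun Y =>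
      haveI := hη Y.obj Y.property
      P'.isoMk (asIso (η.app Y.obj))) fun {X Y} f => ?_).symm
    exact P'.hom_ext (η.naturality f.hom)

/-- The criterion `of_natTrans` for `F` and `G` composed with an equivalence. -/
theorem RestrictToEquivalence.of_natTrans_comp {C D E : Type*} [Category C] [Category D]
    [Category E] {F : C ⥤ D} {G : D ⥤ C} {S : D ⥤ E} {S' : E ⥤ D} {P : ObjectProperty C}
    {P' : ObjectProperty E} (hF : ∀ X, P X → P' (S.obj (F.obj X)))
    (hG : ∀ Y, P' Y → P (G.obj (S'.obj Y))) (e : S' ⋙ S ≅ 𝟭 E) (e' : S ⋙ S' ≅ 𝟭 D)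
    (η : 𝟭 D ⟶ G ⋙ F) (ε : F ⋙ G ⟶ 𝟭 C)
    (hη : ∀ Y, P' Y → IsIso (η.app (S'.obj Y))) (hε : ∀ X, P X → IsIso (ε.app X)) :
    RestrictToEquivalence (F ⋙ S) (S' ⋙ G) P P' := by
  refine RestrictToEquivalence.of_natTrans hF hG
    { app := fun Y => e.inv.app Y ≫ S.map (η.app (S'.obj Y))
      naturality := fun X Y f => ?_ }
    { app := fun X => G.map (e'.hom.app (F.obj X)) ≫ ε.app X
      naturality := fun X Y f => ?_ } ?_ ?_
  · have h := η.naturality (S'.map f)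
    simp only [Functor.id_obj, Functor.id_map, Functor.comp_obj, Functor.comp_map] at h
    have h' := e.inv.naturality f
    simp only [Functor.id_obj, Functor.id_map, Functor.comp_obj, Functor.comp_map] at h'
    simp only [Functor.id_obj, Functor.id_map, Functor.comp_obj, Functor.comp_map, Category.assoc]
    rw [← S.map_comp, ← h, S.map_comp, ← Category.assoc, h', Category.assoc]
  · have h := ε.naturality f
    simp only [Functor.id_obj, Functor.id_map, Functor.comp_obj, Functor.comp_map] at h
    have h' := e'.hom.naturality (F.map f)
    simp only [Functor.id_obj, Functor.id_map, Functor.comp_obj, Functor.comp_map] at h'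
    simp only [Functor.id_obj, Functor.id_map, Functor.comp_obj, Functor.comp_map, Category.assoc]
    rw [← h, ← G.map_comp_assoc, h', G.map_comp, Category.assoc]
  · intro Y hY
    have := hη Y hY
    exact inferInstanceAs (IsIso (e.inv.app Y ≫ S.map (η.app (S'.obj Y))))
  · intro X hX
    have := hε X hX
    exact inferInstanceAs (IsIso (G.map (e'.hom.app (F.obj X)) ≫ ε.app X))

theorem isIso_of_bijective {R : Type*} [Ring R] {M N : ModuleCat R} (f : M ⟶ N)
    (hf : Function.Bijective f.hom) : IsIso f :=
  (LinearEquiv.ofBijective f.hom hf).toModuleIso.isIso_hom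

theorem whittaker_iff {A : Type u} [Ring A] {T : Set A} {V : ModuleCat.{u} A} :
    whittaker T V ↔ Module.Finite A V ∧ LocNil T V := by
  refine and_congr Iff.rfl (forall₃_congr fun t _ v => ⟨fun ⟨n, _, hn⟩ => ⟨n, hn⟩, ?_⟩)
  rintro ⟨n, hn⟩
  exact ⟨n + 1, n.succ_pos, by rw [pow_succ', mul_smul, hn, smul_zero]⟩

section Functors

variable {A : Type u} [Ring A] (k : Type*) [CommRing k] [Algebra k A] (T : Set A)

/-- The unit of `Ind ⊣ Whi`. -/
def whiIndUnit : 𝟭 (ModuleCat.{u} (Reduction k T)) ⟶ Ind k T ⋙ Whi k T where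
  app W := ModuleCat.ofHom (indUnit k T W)

/-- The counit of `Ind ⊣ Whi`. -/
def whiIndCounit : Whi k T ⋙ Ind k T ⟶ 𝟭 (ModuleCat.{u} A) where
  app V := ModuleCat.ofHom (indLift (W := whi T V) LinearMap.id)
  naturality V W f := by
    refine ModuleCat.hom_ext (ind_hom_ext fun v => ?_)
    exact (one_smul A _).trans (congrArg f.hom (one_smul A _)).symm

variable {k T}

theorem IsProjectiveGenerator.isIso_unit (hT : IsProjectiveGenerator T)
    (W : ModuleCat.{u} (Reduction k T)) : IsIso ((whiIndUnit k T).app W) :=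
  isIso_of_bijective _ hT.indUnit_bijective

theorem IsProjectiveGenerator.isIso_counit (hT : IsProjectiveGenerator T)
    (V : ModuleCat.{u} A) (hV : LocNil T V) : IsIso ((whiIndCounit k T).app V) :=
  isIso_of_bijective _ (hT.indLift_bijective hV Function.bijective_id)

variable {R : Type u} [Ring R] [Algebra ℂ A] [Algebra ℂ R] (Ψ : Reduction ℂ T ≃ₐ[ℂ] R)

theorem restrictScalars_finite {R S : Type u} [Ring R] [Ring S] (e : R ≃+* S) (M : ModuleCat.{u} S)
    [Module.Finite S M] :
    Module.Finite R ((ModuleCat.restrictScalars (e : R →+* S)).obj M) := by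
  refine Module.Finite.of_surjective (R := S) (M := M) (σ := (e.symm : S →+* R))
    { toFun := fun m => m
      map_add' := fun _ _ => rfl
      map_smul' := fun s m => ?_ } Function.surjective_id
  refine Eq.trans ?_ (ModuleCat.restrictScalars.smul_def (e : R →+* S) (e.symm s) m).symm
  exact congrArg (fun x : S => x • m) (e.apply_symm_apply s).symm

/-- Restriction of scalars along an isomorphism and then along its inverse. -/
def restrictScalarsCompIso {R S : Type u} [Ring R] [Ring S] (f : R →+* S) (g : S →+* R)
    (h : f.comp g = RingHom.id S) :
    ModuleCat.restrictScalars.{u} f ⋙ ModuleCat.restrictScalars g ≅ 𝟭 _ :=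
  (ModuleCat.restrictScalarsComp' g f _ h.symm).symm ≪≫ ModuleCat.restrictScalarsId' _ rfl

theorem IsProjectiveGenerator.restrictToEquivalence_via (hT : IsProjectiveGenerator T) :
    RestrictToEquivalence (WhiVia T Ψ) (IndVia T Ψ) (whittaker T) (finitelyGenerated R) := by
  refine RestrictToEquivalence.of_natTrans_comp ?_ ?_
    (restrictScalarsCompIso _ _ (RingHom.ext Ψ.apply_symm_apply))
    (restrictScalarsCompIso _ _ (RingHom.ext Ψ.symm_apply_apply))
    (whiIndUnit ℂ T) (whiIndCounit ℂ T) (fun _ _ => hT.isIso_unit _)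
    fun V hV => hT.isIso_counit V (whittaker_iff.1 hV).2
  · intro V hV
    rw [whittaker_iff] at hV
    have := hV.1
    have : Module.Finite (Reduction ℂ T) ((Whi ℂ T).obj V) := hT.whi_finite ℂ hV.2
    exact restrictScalars_finite Ψ.symm.toRingEquiv ((Whi ℂ T).obj V)
  · intro W hW
    have : Module.Finite R W := hW
    have : Module.Finite (Reduction ℂ T)
        ((ModuleCat.restrictScalars (Ψ : Reduction ℂ T →+* R)).obj W) :=
      restrictScalars_finite Ψ.toRingEquiv W
    exact whittaker_iff.2 ⟨ind_finite ℂ T _, ind_locNil ℂ T _ hT.locNil⟩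

end Functors

/-! ### Reduction by stages -/

section TwoStages

variable {A : Type u} [Ring A] [Algebra ℂ A]

theorem cls_eq_cls_iff {T : Set A} {X X' : A} {hX : X ∈ normalizer ℂ T}
    {hX' : X' ∈ normalizer ℂ T} :
    cls ℂ T X hX = cls ℂ T X' hX' ↔ X - X' ∈ Ideal.span T :=
  Ideal.Quotient.mk_eq_mk_iff_sub_mem _ _

theorem cls_pow_smul_coe {T : Set A} {V : Type*} [AddCommGroup V] [Module A V] {X : A}
    (hX : X ∈ normalizer ℂ T) (n : ℕ) (v : whi T V) :
    ((cls ℂ T X hX ^ n • v : whi T V) : V) = X ^ n • (v : V) := by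
  induction n with
  | zero => rw [pow_zero, pow_zero, one_smul, one_smul]
  | succ n ih => rw [pow_succ', pow_succ', mul_smul, mul_smul, cls_smul_coe, ih]

/-- The reduction of `A` by `T₂` can be done in two stages: first by a subset `T₁` of `T₂`, then by
the set `T₀` of the classes of a subset `Y` of `T₂` which normalizes `T₁`. -/
structure IsTwoStage (T₁ T₂ Y : Set A) (T₀ : Set (Reduction ℂ T₁)) : Prop where
  gen₁ : IsProjectiveGenerator T₁
  gen₂ : IsProjectiveGenerator T₂
  smul_mem_nilVectors : ∀ (V : Type u) [AddCommGroup V] [Module A V], ∀ t ∈ T₂,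
    ∀ v ∈ nilVectors t V, ∀ a : A, a • v ∈ nilVectors t V
  subset : T₁ ⊆ T₂
  subset' : Y ⊆ T₂
  mem_normalizer : ∀ y ∈ Y, y ∈ normalizer ℂ T₁
  exists_add : ∀ t ∈ T₂, ∃ t₁ ∈ T₁, ∃ y ∈ Y, t = t₁ + y
  mem_iff : ∀ x, x ∈ T₀ ↔ ∃ (y : A) (hy : y ∈ Y), x = cls ℂ T₁ y (mem_normalizer y hy)

namespace IsTwoStage

variable {T₁ T₂ Y : Set A} {T₀ : Set (Reduction ℂ T₁)}

theorem whi_le (h : IsTwoStage T₁ T₂ Y T₀) {V : Type*} [AddCommGroup V] [Module A V] :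
    whi T₂ V ≤ whi T₁ V :=
  fun _ hv t ht => hv t (h.subset ht)

/-- An element `t₁ + y` of `T₂` acts as `y` on vectors killed by `T₁`. -/
theorem mem_whi₂_iff (h : IsTwoStage T₁ T₂ Y T₀) {V : Type*} [AddCommGroup V] [Module A V]
    (v : whi T₁ V) : (v : V) ∈ whi T₂ V ↔ v ∈ whi T₀ (whi T₁ V) := by
  constructor
  · intro hv x hx
    obtain ⟨y, hy, rfl⟩ := (h.mem_iff x).1 hx
    exact Subtype.ext (hv y (h.subset' hy))
  · intro hv t ht
    obtain ⟨t₁, ht₁, y, hy, rfl⟩ := h.exists_add t ht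
    rw [add_smul, v.2 t₁ ht₁, zero_add]
    exact congrArg Subtype.val (hv _ ((h.mem_iff _).2 ⟨y, hy, rfl⟩))

variable (T₁ T₂) in
/-- The class of `1` in `A / A T₂`, as a vector killed by `T₁`. -/
def oneVec (h : T₁ ⊆ T₂) : whi T₁ (Q T₂) :=
  ⟨Submodule.Quotient.mk 1, fun t ht => one_mem_whi t (h ht)⟩

theorem cls_smul_oneVec (h : T₁ ⊆ T₂) {X : A} (hX : X ∈ normalizer ℂ T₁) :
    ((cls ℂ T₁ X hX • oneVec T₁ T₂ h : whi T₁ (Q T₂)) : Q T₂) = Submodule.Quotient.mk X := by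
  rw [cls_smul_coe]
  exact congrArg Submodule.Quotient.mk (mul_one X)

theorem oneVec_mem (h : IsTwoStage T₁ T₂ Y T₀) :
    oneVec T₁ T₂ h.subset ∈ whi T₀ (whi T₁ (Q T₂)) :=
  (h.mem_whi₂_iff _).1 one_mem_whi

/-- This embeds `Q₀` in `Whi₁(Q₂)` by acting on the class of `1`, which `T₀` kills. For the
converse, the image of `A T₂` in `A / A T₁` lies in the `A`-span of the classes from the left ideal
of `T₀`, and `mem_of_coe_mem_span` finds its invariants. -/
theorem cls_mem_span_iff (h : IsTwoStage T₁ T₂ Y T₀) {X : A} (hX : X ∈ normalizer ℂ T₁) :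
    cls ℂ T₁ X hX ∈ Ideal.span T₀ ↔ X ∈ Ideal.span T₂ := by
  constructor
  · intro hmem
    have := smul_eq_zero_of_mem_span hmem ⟨_, h.oneVec_mem⟩
    rw [← Submodule.Quotient.mk_eq_zero, ← cls_smul_oneVec h.subset hX, this]
    rfl
  · intro hmem
    let o : whi T₁ (Q T₁) := oneVec T₁ T₁ subset_rfl
    let N : Submodule (Reduction ℂ T₁) (whi T₁ (Q T₁)) :=
      Submodule.map (LinearMap.toSpanSingleton (Reduction ℂ T₁) _ o) (Ideal.span T₀)
    have hle : Ideal.span T₂ ≤ Submodule.comap (Submodule.mkQ (Ideal.span T₁))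
        (Submodule.span A ((↑) '' (N : Set (whi T₁ (Q T₁))) : Set (Q T₁))) := by
      refine Submodule.span_le.2 fun t ht => ?_
      obtain ⟨t₁, ht₁, y, hy, rfl⟩ := h.exists_add t ht
      refine Submodule.mem_comap.2 ?_
      rw [map_add, Submodule.mkQ_apply,
        (Submodule.Quotient.mk_eq_zero _).2 (Ideal.subset_span ht₁), zero_add]
      refine Submodule.subset_span ⟨_, ⟨cls ℂ T₁ y (h.mem_normalizer y hy),
        Ideal.subset_span ((h.mem_iff _).2 ⟨y, hy, rfl⟩), rfl⟩, ?_⟩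
      exact cls_smul_oneVec subset_rfl _
    obtain ⟨r, hr, hrX⟩ := h.gen₁.mem_of_coe_mem_span N (cls ℂ T₁ X hX • o) (by
      rw [cls_smul_oneVec]
      exact hle hmem)
    obtain ⟨X', hX', rfl⟩ := cls_surjective r
    have heq : (Submodule.Quotient.mk X' : Q T₁) = Submodule.Quotient.mk X := by
      rw [← cls_smul_oneVec subset_rfl hX', ← cls_smul_oneVec subset_rfl hX]
      exact congrArg Subtype.val hrX
    rwa [← cls_eq_cls_iff.2 ((Submodule.Quotient.eq _).1 heq)]

/-- The class of `1` generates `Q₂` over `A`, hence `Whi₁(Q₂)` over the reduction. With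
`cls_mem_span_iff`, this identifies `Whi₁(Q₂)` with `Q₀`. -/
theorem exists_cls_smul_oneVec (h : IsTwoStage T₁ T₂ Y T₀) (v : whi T₁ (Q T₂)) :
    ∃ X hX, cls ℂ T₁ X hX • oneVec T₁ T₂ h.subset = v := by
  have := h.gen₁.mem_of_coe_mem_span
    (Submodule.span (Reduction ℂ T₁) {oneVec T₁ T₂ h.subset}) v (by
      obtain ⟨a, ha⟩ := Submodule.Quotient.mk_surjective _ (v : Q T₂)
      rw [← ha, ← mul_one a, ← smul_eq_mul, Submodule.Quotient.mk_smul]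
      exact Submodule.smul_mem _ _ (Submodule.subset_span
        ⟨_, Submodule.mem_span_singleton_self _, rfl⟩))
  obtain ⟨r, hr⟩ := Submodule.mem_span_singleton.1 this
  obtain ⟨X, hX, rfl⟩ := cls_surjective r
  exact ⟨X, hX, hr⟩

theorem locNil_whi (h : IsTwoStage T₁ T₂ Y T₀) {V : Type*} [AddCommGroup V] [Module A V]
    (hV : LocNil T₂ V) : LocNil T₀ (whi T₁ V) := by
  intro x hx v
  obtain ⟨y, hy, rfl⟩ := (h.mem_iff x).1 hx
  obtain ⟨n, hn⟩ := hV y (h.subset' hy) v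
  exact ⟨n, Subtype.ext (by rw [cls_pow_smul_coe, hn]; rfl)⟩

/-- Powers of `t₁ + y` act on `1 ⊗ w` as powers of `y` act on `w`, since `y (1 ⊗ w) = 1 ⊗ y w` is
again killed by `t₁`. The vectors killed by a power of `t` form an `A`-submodule, so the generators
`1 ⊗ w` suffice. -/
theorem locNil_ind (h : IsTwoStage T₁ T₂ Y T₀) {W : Type u} [AddCommGroup W]
    [Module (Reduction ℂ T₁) W] (hW : LocNil T₀ W) : LocNil T₂ (ind ℂ T₁ W) := by
  intro t ht x
  induction x using ind_induction with
  | zero => exact zero_mem _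
  | add x y hx hy => exact add_mem hx hy
  | smul a w =>
    refine h.smul_mem_nilVectors _ t ht _ ?_ a
    obtain ⟨t₁, ht₁, y, hy, rfl⟩ := h.exists_add t ht
    have key (n : ℕ) : (t₁ + y) ^ n • (indUnit ℂ T₁ W w : ind ℂ T₁ W) =
        indUnit ℂ T₁ W (cls ℂ T₁ y (h.mem_normalizer y hy) ^ n • w) := by
      induction n with
      | zero => rw [pow_zero, pow_zero, one_smul, one_smul]
      | succ n ih =>
        rw [pow_succ', pow_succ', mul_smul, mul_smul, ih, add_smul,
          (indUnit ℂ T₁ W _).2 t₁ ht₁, zero_add,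
          map_smul (indUnit ℂ T₁ W) (cls ℂ T₁ y _) (_ ^ n • w), cls_smul_coe]
    obtain ⟨n, hn⟩ := hW _ ((h.mem_iff _).2 ⟨y, hy, rfl⟩) w
    exact ⟨n, by rw [key, hn, map_zero]; rfl⟩

/-- Each property is that of `T₂`, transported through the first stage: `Q₀` embeds in `Whi₁(Q₂)`,
and the `T₂`-invariants of `Q₁ ⊗ V` are the `T₀`-invariants of `V`. -/
theorem gen₀ (h : IsTwoStage T₁ T₂ Y T₀) : IsProjectiveGenerator T₀ where
  locNil := by
    refine (h.locNil_whi h.gen₂.locNil).of_injective (whiHom ⟨_, h.oneVec_mem⟩) ?_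
    rw [injective_iff_map_eq_zero]
    intro q hq
    obtain ⟨r, rfl⟩ := Submodule.Quotient.mk_surjective _ q
    obtain ⟨X, hX, rfl⟩ := cls_surjective r
    rw [Submodule.Quotient.mk_eq_zero]
    refine (h.cls_mem_span_iff hX).2 ?_
    rw [← Submodule.Quotient.mk_eq_zero, ← cls_smul_oneVec h.subset hX]
    exact congrArg Subtype.val hq
  exists_sub_mem V _ _ hV K v hv := by
    let N := K.map (indUnit ℂ T₁ V)
    obtain ⟨w, hw, hvw⟩ := h.gen₂.exists_sub_mem (ind ℂ T₁ V) (h.locNil_ind hV)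
      (Submodule.span A ((↑) '' (N : Set (whi T₁ (ind ℂ T₁ V))) : Set (ind ℂ T₁ V)))
      (indUnit ℂ T₁ V v) (fun t ht => by
        obtain ⟨t₁, ht₁, y, hy, rfl⟩ := h.exists_add t ht
        rw [add_smul, (indUnit ℂ T₁ V v).2 t₁ ht₁, zero_add,
          ← cls_smul_coe ℂ T₁ _ y (h.mem_normalizer y hy), ← map_smul (indUnit ℂ T₁ V)]
        exact Submodule.subset_span
          ⟨_, ⟨_, hv _ ((h.mem_iff _).2 ⟨y, hy, rfl⟩), rfl⟩, rfl⟩)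
    -- As a difference of vectors killed by `T₁`, `w` is invariant; lying in `A N`, it comes from
    -- `K`.
    have hw₁ : w ∈ whi T₁ (ind ℂ T₁ V) := by
      have := sub_mem (indUnit ℂ T₁ V v).2 (h.whi_le hvw)
      rwa [sub_sub_cancel] at this
    obtain ⟨κ, hκ, hκw⟩ := h.gen₁.mem_of_coe_mem_span N ⟨w, hw₁⟩ hw
    refine ⟨κ, hκ, fun x hx => ?_⟩
    apply h.gen₁.indUnit_injective (k := ℂ)
    rw [map_smul, map_sub, hκw, map_zero]
    exact (h.mem_whi₂_iff (indUnit ℂ T₁ V v - ⟨w, hw₁⟩)).1 hvw x hx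
  eq_zero V _ _ hV h₀ v := by
    apply h.gen₁.indUnit_injective (k := ℂ)
    rw [map_zero]
    refine Subtype.ext (h.gen₂.eq_zero (ind ℂ T₁ V) (h.locNil_ind hV) (fun x hx => ?_) _)
    obtain ⟨w, hw⟩ := h.gen₁.indUnit_surjective (k := ℂ) (W := V) ⟨x, h.whi_le hx⟩
    have hx' := (h.mem_whi₂_iff ⟨x, h.whi_le hx⟩).1 hx
    have : w = 0 := h₀ w fun t ht => by
      apply h.gen₁.indUnit_injective (k := ℂ)
      rw [map_smul, hw, hx' t ht, map_zero]
    rw [this, map_zero] at hw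
    exact (congrArg Subtype.val hw).symm

/-- The normalizer of `T₀` preserves `Whi₀(Whi₁(Q₂)) = Whi₂(Q₂)`, which contains the class of `1`.
-/
theorem mem_normalizer₂ (h : IsTwoStage T₁ T₂ Y T₀) {X : A} (h₁ : X ∈ normalizer ℂ T₁)
    (h₀ : cls ℂ T₁ X h₁ ∈ normalizer ℂ T₀) : X ∈ normalizer ℂ T₂ := by
  rw [← mk_mem_whi_iff, ← cls_smul_oneVec h.subset h₁, h.mem_whi₂_iff]
  exact (cls ℂ T₀ _ h₀ • (⟨_, h.oneVec_mem⟩ : whi T₀ (whi T₁ (Q T₂)))).2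

theorem span_le (h : IsTwoStage T₁ T₂ Y T₀) : Ideal.span T₁ ≤ Ideal.span T₂ :=
  Ideal.span_mono h.subset

/-- Every element of the normalizer of `T₀` has a representative in `A`. -/
theorem exists_rep (x : normalizer ℂ T₀) : ∃ X h₁, cls ℂ T₁ X h₁ = x.1 :=
  cls_surjective x.1

/-- The class modulo `A T₂` of the representatives of an element of the normalizer of `T₀`. -/
def normalizerToFun (h : IsTwoStage T₁ T₂ Y T₀) (x : normalizer ℂ T₀) : Reduction ℂ T₂ :=
  cls ℂ T₂ (exists_rep x).choose (h.mem_normalizer₂ (exists_rep x).choose_spec.choose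
    ((exists_rep x).choose_spec.choose_spec.symm ▸ x.2))

/-- Two representatives differ by an element of `A T₁ ⊆ A T₂`. -/
theorem normalizerToFun_eq (h : IsTwoStage T₁ T₂ Y T₀) {x : normalizer ℂ T₀} {X : A}
    {h₁ : X ∈ normalizer ℂ T₁} (hx : x.1 = cls ℂ T₁ X h₁) (h₂ : X ∈ normalizer ℂ T₂) :
    h.normalizerToFun x = cls ℂ T₂ X h₂ :=
  cls_eq_cls_iff.2 (h.span_le (cls_eq_cls_iff.1
    ((exists_rep x).choose_spec.choose_spec.trans hx)))

/-- The homomorphism `(X mod A T₁) ↦ X mod A T₂` on the normalizer of `T₀`. -/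
def normalizerHom (h : IsTwoStage T₁ T₂ Y T₀) : normalizer ℂ T₀ →ₐ[ℂ] Reduction ℂ T₂ where
  toFun := h.normalizerToFun
  map_one' := h.normalizerToFun_eq (h₁ := one_mem _) rfl (one_mem _)
  map_zero' := h.normalizerToFun_eq (h₁ := zero_mem _) rfl (zero_mem _)
  map_mul' x y := by
    obtain ⟨X, hX, hx⟩ := exists_rep x
    obtain ⟨X', hX', hx'⟩ := exists_rep y
    have m := h.mem_normalizer₂ hX (hx.symm ▸ x.2)
    have m' := h.mem_normalizer₂ hX' (hx'.symm ▸ y.2)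
    rw [h.normalizerToFun_eq hx.symm m, h.normalizerToFun_eq hx'.symm m']
    refine h.normalizerToFun_eq (h₁ := mul_mem hX hX') ?_ (mul_mem m m')
    change x.1 * y.1 = _
    rw [← hx, ← hx']
    rfl
  map_add' x y := by
    obtain ⟨X, hX, hx⟩ := exists_rep x
    obtain ⟨X', hX', hx'⟩ := exists_rep y
    have m := h.mem_normalizer₂ hX (hx.symm ▸ x.2)
    have m' := h.mem_normalizer₂ hX' (hx'.symm ▸ y.2)
    rw [h.normalizerToFun_eq hx.symm m, h.normalizerToFun_eq hx'.symm m']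
    refine h.normalizerToFun_eq (h₁ := add_mem hX hX') ?_ (add_mem m m')
    change x.1 + y.1 = _
    rw [← hx, ← hx']
    rfl
  commutes' c := h.normalizerToFun_eq (h₁ := algebraMap_mem _ c) rfl (algebraMap_mem _ c)

/-- The homomorphism `(X mod A T₁) mod I₀ ↦ X mod A T₂`. -/
def reductionHom (h : IsTwoStage T₁ T₂ Y T₀) : Reduction ℂ T₀ →ₐ[ℂ] Reduction ℂ T₂ :=
  Ideal.Quotient.liftₐ (redIdeal ℂ T₀) h.normalizerHom fun x hx => by
    obtain ⟨X, hX, hxX⟩ := exists_rep x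
    have m := h.mem_normalizer₂ hX (hxX.symm ▸ x.2)
    refine (h.normalizerToFun_eq hxX.symm m).trans (cls_eq_zero_iff.2 ?_)
    rw [← h.cls_mem_span_iff hX, hxX]
    exact hx

theorem reductionHom_cls (h : IsTwoStage T₁ T₂ Y T₀) {X : A} (h₁ : X ∈ normalizer ℂ T₁)
    (h₀ : cls ℂ T₁ X h₁ ∈ normalizer ℂ T₀) :
    h.reductionHom (cls ℂ T₀ (cls ℂ T₁ X h₁) h₀) = cls ℂ T₂ X (h.mem_normalizer₂ h₁ h₀) :=
  h.normalizerToFun_eq rfl _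

theorem reductionHom_bijective (h : IsTwoStage T₁ T₂ Y T₀) :
    Function.Bijective h.reductionHom := by
  constructor
  · rw [injective_iff_map_eq_zero]
    intro r hr
    obtain ⟨x, h₀, rfl⟩ := cls_surjective r
    obtain ⟨X, h₁, rfl⟩ := cls_surjective x
    rw [h.reductionHom_cls, cls_eq_zero_iff, ← h.cls_mem_span_iff h₁] at hr
    exact cls_eq_zero_iff.2 hr
  · intro r
    obtain ⟨X, h₂, rfl⟩ := cls_surjective r
    -- `X` may fail to normalize `T₁`; it is replaced by an element `X'` of its class modulo `A T₂`
    -- that does.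
    have hX := (mk_mem_whi_iff ℂ).2 h₂
    obtain ⟨X', h₁, hX'⟩ := h.exists_cls_smul_oneVec ⟨_, h.whi_le hX⟩
    have e : (Submodule.Quotient.mk X' : Q T₂) = Submodule.Quotient.mk X := by
      rw [← cls_smul_oneVec h.subset h₁, hX']
    have h₂' : X' ∈ normalizer ℂ T₂ := by rwa [← mk_mem_whi_iff, e]
    have h₀ : cls ℂ T₁ X' h₁ ∈ normalizer ℂ T₀ := by
      intro x hx
      obtain ⟨y, hy, rfl⟩ := (h.mem_iff x).1 hx
      have hy₁ := h.mem_normalizer y hy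
      exact (h.cls_mem_span_iff (X := ⁅y, X'⁆)
        (sub_mem (mul_mem hy₁ h₁) (mul_mem h₁ hy₁))).2 (h₂' y (h.subset' hy))
    exact ⟨cls ℂ T₀ _ h₀, (h.reductionHom_cls h₁ h₀).trans
      (cls_eq_cls_iff.2 ((Submodule.Quotient.eq _).1 e))⟩

/-- The isomorphism `(X mod A T₁) mod I₀ ↦ X mod A T₂`. -/
def reductionEquiv (h : IsTwoStage T₁ T₂ Y T₀) : Reduction ℂ T₀ ≃ₐ[ℂ] Reduction ℂ T₂ :=
  AlgEquiv.ofBijective h.reductionHom h.reductionHom_bijective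

theorem reductionEquiv_cls (h : IsTwoStage T₁ T₂ Y T₀) {X : A} (h₁ : X ∈ normalizer ℂ T₁)
    (h₀ : cls ℂ T₁ X h₁ ∈ normalizer ℂ T₀) :
    h.reductionEquiv (cls ℂ T₀ (cls ℂ T₁ X h₁) h₀) = cls ℂ T₂ X (h.mem_normalizer₂ h₁ h₀) :=
  h.reductionHom_cls h₁ h₀

theorem whittaker_le (h : IsTwoStage T₁ T₂ Y T₀) : whittaker T₂ ≤ whittaker T₁ :=
  fun _ hV => ⟨hV.1, fun t ht => hV.2 t (h.subset ht)⟩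

theorem restrictToEquivalence₁ (h : IsTwoStage T₁ T₂ Y T₀) :
    RestrictToEquivalence (Whi ℂ T₁) (Ind ℂ T₁) (whittaker T₂) (whittaker T₀) := by
  refine RestrictToEquivalence.of_natTrans ?_ ?_ (whiIndUnit ℂ T₁) (whiIndCounit ℂ T₁)
    (fun W _ => h.gen₁.isIso_unit W)
    fun V hV => h.gen₁.isIso_counit V ((whittaker_iff.1 hV).2.mono h.subset)
  · intro V hV
    rw [whittaker_iff] at hV
    have := hV.1
    exact whittaker_iff.2 ⟨h.gen₁.whi_finite ℂ (hV.2.mono h.subset), h.locNil_whi hV.2⟩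
  · intro W hW
    rw [whittaker_iff] at hW
    have := hW.1
    exact whittaker_iff.2 ⟨ind_finite ℂ T₁ W, h.locNil_ind hW.2⟩

/-- The vectors killed by `T₂` are the vectors killed by `T₀` among those killed by `T₁`. -/
def whiWhiEquiv (h : IsTwoStage T₁ T₂ Y T₀) (V : ModuleCat.{u} A) :
    (Whi ℂ T₁ ⋙ WhiVia T₀ h.reductionEquiv).obj V ≃ₗ[Reduction ℂ T₂] (Whi ℂ T₂).obj V where
  toFun v := (⟨_, (h.mem_whi₂_iff v.1).2 v.2⟩ : whi T₂ V)
  invFun v := (⟨⟨v.1, h.whi_le v.2⟩, (h.mem_whi₂_iff ⟨v.1, h.whi_le v.2⟩).1 v.2⟩ :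
    whi T₀ (whi T₁ V))
  left_inv _ := rfl
  right_inv _ := rfl
  map_add' _ _ := rfl
  map_smul' r v := by
    obtain ⟨r, rfl⟩ := h.reductionEquiv.surjective r
    obtain ⟨x, h₀, rfl⟩ := cls_surjective r
    obtain ⟨X, h₁, rfl⟩ := cls_surjective x
    -- Scalars act through the inverse of `reductionEquiv`, which cancels.
    have e : (h.reductionEquiv (cls ℂ T₀ _ h₀) • v) =
        (cls ℂ T₀ (cls ℂ T₁ X h₁) h₀ • (show whi T₀ (whi T₁ V) from v) : whi T₀ (whi T₁ V)) :=
      congrArg (fun r : Reduction ℂ T₀ => r • (show whi T₀ (whi T₁ V) from v))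
        (h.reductionEquiv.symm_apply_apply _)
    rw [e, h.reductionEquiv_cls]
    rfl

/-- Taking the vectors killed by `T₂` is the composition of the two stages. -/
def whiWhiIso (h : IsTwoStage T₁ T₂ Y T₀) :
    (whittaker T₂).ι ⋙ Whi ℂ T₁ ⋙ WhiVia T₀ h.reductionEquiv ≅ (whittaker T₂).ι ⋙ Whi ℂ T₂ :=
  NatIso.ofComponents fun V => (h.whiWhiEquiv V.obj).toModuleIso

theorem whiWhiIso_apply (h : IsTwoStage T₁ T₂ Y T₀) (V : (whittaker T₂).FullSubcategory)
    (v : whi T₀ (whi T₁ V.obj)) :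
    (whi T₂ V.obj).subtype ((h.whiWhiIso.hom.app V).hom v) = ((v : whi T₁ V.obj) : V.obj) :=
  rfl

end IsTwoStage

end TwoStages

/-! ### Modules with a locally nilpotent action of a shifted good algebra -/

section Core

theorem smul_smul_eq_add_lie {A V : Type*} [Ring A] [AddCommGroup V] [Module A V] (a b : A)
    (v : V) : a • b • v = b • a • v + ⁅a, b⁆ • v := by
  rw [Ring.lie_def, sub_smul, mul_smul, mul_smul, add_sub_cancel]

variable {g : Type*} [LieRing g] [LieAlgebra ℂ g]

variable {A : Type*} [Ring A] [Algebra ℂ A]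

/-- A homogeneous basis `x` of `m` and homogeneous elements `z` such that `χ([x i, z j])` is `1` for
`i = j` and `0` otherwise, for a grading `Γ` and a character `χ` of `m` of degree `2`; and a
homomorphism of Lie algebras `φ` to an associative algebra. -/
structure IsAdapted (φ : g →ₗ[ℂ] A) (Γ : ℤ → Submodule ℂ g) (χ : Module.Dual ℂ g) (m : LieSubalgebra ℂ g)
    {ι : Type*} [Fintype ι] [DecidableEq ι] (x z : ι → g) (n : ι → ℤ) : Prop where
  map_lie : ∀ a b, φ ⁅a, b⁆ = ⁅φ a, φ b⁆
  lie_mem : ∀ i j, ∀ a ∈ Γ i, ∀ b ∈ Γ j, ⁅a, b⁆ ∈ Γ (i + j)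
  le : ∀ i, 2 ≤ i → ∀ a ∈ Γ i, a ∈ m
  char_lie : ∀ a ∈ m, ∀ b ∈ m, χ ⁅a, b⁆ = 0
  char_eq_zero : ∀ i, i ≠ 2 → ∀ a ∈ Γ i, χ a = 0
  x_mem : ∀ i, x i ∈ m
  x_mem_grade : ∀ i, x i ∈ Γ (n i)
  one_le : ∀ i, 1 ≤ n i
  z_mem_grade : ∀ i, z i ∈ Γ (2 - n i)
  eq_sum : ∀ a ∈ m, a = ∑ i, χ ⁅a, z i⁆ • x i
  dual : ∀ i j, χ ⁅x i, z j⁆ = if i = j then 1 else 0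

variable (φ : g →ₗ[ℂ] A) (χ : Module.Dual ℂ g)

/-- The linear map `a ↦ φ(a) - χ(a)`. -/
def tw : g →ₗ[ℂ] A := φ - Algebra.linearMap ℂ A ∘ₗ χ

theorem tw_apply (a : g) : tw φ χ a = φ a - algebraMap ℂ A (χ a) :=
  rfl

variable {V : Type*} [AddCommGroup V] [Module A V]

namespace IsAdapted

variable {Γ : ℤ → Submodule ℂ g} {χ : Module.Dual ℂ g} {m : LieSubalgebra ℂ g}
  {ι : Type*} {x z : ι → g} {n : ι → ℤ}

theorem lie_tw [Fintype ι] [DecidableEq ι]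
    (h : IsAdapted φ Γ χ m x z n) (a b : g) : ⁅tw φ χ a, φ b⁆ = φ ⁅a, b⁆ := by
  rw [tw_apply, h.map_lie, Ring.lie_def, Ring.lie_def, sub_mul, mul_sub, Algebra.commutes,
    sub_sub_sub_cancel_right]

theorem lie_tw_tw [Fintype ι] [DecidableEq ι]
    (h : IsAdapted φ Γ χ m x z n) {a b : g} (ha : a ∈ m) (hb : b ∈ m) :
    ⁅tw φ χ a, tw φ χ b⁆ = tw φ χ ⁅a, b⁆ := by
  rw [tw_apply φ χ ⁅a, b⁆, h.char_lie a ha b hb, map_zero, sub_zero, ← h.lie_tw φ, Ring.lie_def,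
    Ring.lie_def, tw_apply φ χ b, sub_mul, mul_sub, Algebra.commutes, sub_sub_sub_cancel_right]

variable [Module ℂ V] [IsScalarTower ℂ A V]

/-- As `χ` lives in degree `2` and `[a, z k]` has degree `j + 2 - n k`, only the `x k` of degree `j`
occur in the expansion of `a`. -/
theorem tw_smul_mem_of_grade [Fintype ι] [DecidableEq ι]
    (h : IsAdapted φ Γ χ m x z n) (P : Submodule ℂ V) {a : g} (ha : a ∈ m)
    {j : ℤ} (haj : a ∈ Γ j) {v : V} (hv : ∀ k, n k = j → tw φ χ (x k) • v ∈ P) :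
    tw φ χ a • v ∈ P := by
  rw [h.eq_sum a ha, map_sum, Finset.sum_smul]
  refine sum_mem fun k _ => ?_
  rw [map_smul, smul_assoc]
  by_cases hk : n k = j
  · exact P.smul_mem _ (hv k hk)
  · rw [h.char_eq_zero _ _ _ (h.lie_mem _ _ a haj (z k) (h.z_mem_grade k)), zero_smul]
    · exact zero_mem _
    · omega

theorem tw_smul_mem [Fintype ι] [DecidableEq ι]
    (h : IsAdapted φ Γ χ m x z n) (P : Submodule ℂ V) {a : g} (ha : a ∈ m)
    {v : V} (hv : ∀ k, tw φ χ (x k) • v ∈ P) : tw φ χ a • v ∈ P := by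
  rw [h.eq_sum a ha, map_sum, Finset.sum_smul]
  refine sum_mem fun k _ => ?_
  rw [map_smul, smul_assoc]
  exact P.smul_mem _ (hv k)

/-- A version of Engel's theorem relative to a stable subspace. -/
theorem exists_notMem [Fintype ι] [DecidableEq ι]
    (h : IsAdapted φ Γ χ m x z n)
    (hV : ∀ a ∈ m, ∀ v : V, v ∈ nilVectors (tw φ χ a) V) (S : Submodule ℂ V)
    (hS : ∀ i, ∀ v ∈ S, tw φ χ (x i) • v ∈ S) {v₀ : V} (hv₀ : v₀ ∉ S) :
    ∃ v, v ∉ S ∧ ∀ i, tw φ χ (x i) • v ∈ S := by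
  -- Basis elements enter by decreasing degree: `[x i, x a]` then expands in elements of degree
  -- above `n i`, which are already in `s`.
  suffices ∀ s : Finset ι, (∀ i ∈ s, ∀ k, n i < n k → k ∈ s) →
      ∃ v, v ∉ S ∧ ∀ i ∈ s, tw φ χ (x i) • v ∈ S by
    obtain ⟨v, hv, hv'⟩ := this Finset.univ fun _ _ _ _ => Finset.mem_univ _
    exact ⟨v, hv, fun i => hv' i (Finset.mem_univ i)⟩
  intro s
  induction s using Finset.induction_on_min_value n with
  | empty => exact fun _ => ⟨v₀, hv₀, fun i hi => absurd hi (Finset.notMem_empty i)⟩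
  | insert a s _ hmin ih =>
    intro hs
    have hs' : ∀ i ∈ s, ∀ k, n i < n k → k ∈ s := by
      intro i hi k hk
      rcases Finset.mem_insert.1 (hs i (Finset.mem_insert_of_mem hi) k hk) with rfl | hks
      · exact absurd (hmin i hi) (not_le.2 hk)
      · exact hks
    obtain ⟨v, hv, hvs⟩ := ih hs'
    have hpow (j : ℕ) : ∀ i ∈ s, tw φ χ (x i) • tw φ χ (x a) ^ j • v ∈ S := by
      induction j with
      | zero => simpa using hvs
      | succ j ihj =>
        intro i hi
        rw [pow_succ', mul_smul, smul_smul_eq_add_lie, h.lie_tw_tw φ (h.x_mem i) (h.x_mem a)]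
        refine add_mem (hS a _ (ihj i hi)) (h.tw_smul_mem_of_grade φ S
          (m.lie_mem (h.x_mem i) (h.x_mem a))
          (h.lie_mem _ _ _ (h.x_mem_grade i) _ (h.x_mem_grade a)) fun k hk => ?_)
        exact ihj k (hs' i hi k (by have := h.one_le a; omega))
    have hex : ∃ j : ℕ, tw φ χ (x a) ^ j • v ∈ S := by
      obtain ⟨j, hj⟩ := hV _ (h.x_mem a) v
      exact ⟨j, hj ▸ zero_mem S⟩
    classical
    -- If `j + 1` is the first exponent that carries `v` into `S`, the `j`-th power is the witness.
    obtain ⟨j, hj⟩ : ∃ j, Nat.find hex = j + 1 := by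
      refine Nat.exists_eq_succ_of_ne_zero fun h0 => hv ?_
      simpa [h0] using Nat.find_spec hex
    refine ⟨tw φ χ (x a) ^ j • v, Nat.find_min hex (by omega), fun i hi => ?_⟩
    rcases Finset.mem_insert.1 hi with rfl | hi
    · have := Nat.find_spec hex
      rwa [hj, pow_succ', mul_smul] at this
    · exact hpow j i hi

variable (χ x V) in
/-- The vectors that are killed by the products of `k` of the elements `φ(x i) - χ(x i)`. -/
def chain : ℕ → Submodule ℂ V
  | 0 => ⊥
  | k + 1 => ⨅ i, (chain k).comap (Algebra.lsmul ℂ ℂ V (tw φ χ (x i)))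

theorem mem_chain_succ {k : ℕ} {v : V} :
    v ∈ chain φ V χ x (k + 1) ↔ ∀ i, tw φ χ (x i) • v ∈ chain φ V χ x k := by
  simp [chain]

theorem chain_mono : Monotone (chain φ V χ x) := by
  refine monotone_nat_of_le_succ fun k => ?_
  induction k with
  | zero => exact bot_le
  | succ k ih => exact fun v hv => (mem_chain_succ φ).2 fun i => ih ((mem_chain_succ φ).1 hv i)

/-- If the union of the chain were proper, `exists_notMem` would give a vector outside it whose
finitely many images lie in one term, so that it lies in the next. -/
theorem exists_mem_chain [Fintype ι] [DecidableEq ι]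
    (h : IsAdapted φ Γ χ m x z n)
    (hV : ∀ a ∈ m, ∀ v : V, v ∈ nilVectors (tw φ χ a) V) (v : V) :
    ∃ k, v ∈ chain φ V χ x k := by
  by_contra hv
  have hdir : Directed (· ≤ ·) (chain φ V χ x) := (chain_mono φ).directed_le
  rw [← Submodule.mem_iSup_of_directed _ hdir] at hv
  obtain ⟨w, hw, hw'⟩ := h.exists_notMem φ hV (⨆ k, chain φ V χ x k) (fun i v hv => by
    rw [Submodule.mem_iSup_of_directed _ hdir] at hv ⊢
    obtain ⟨k, hk⟩ := hv
    exact ⟨k, (mem_chain_succ φ).1 (chain_mono φ k.le_succ hk) i⟩) hv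
  refine hw ((Submodule.mem_iSup_of_directed _ hdir).2 ?_)
  simp only [Submodule.mem_iSup_of_directed _ hdir] at hw'
  choose k hk using hw'
  exact ⟨Finset.univ.sup k + 1, (mem_chain_succ φ).2 fun i =>
    chain_mono φ (Finset.le_sup (Finset.mem_univ i)) (hk i)⟩

variable (Γ χ x) in
/-- The filtration of `V` in which the elements of `Γ j`, `j ≤ 1`, have degree `3 - 2 j`, and the
vectors of the `k`-th term of the chain have degree `L k`. -/
inductive Fil (L : ℤ) : ℤ → V → Prop
  | of_mem_chain (k : ℕ) (v : V) : v ∈ chain φ V χ x k → Fil L (L * k) v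
  | zero (d : ℤ) : Fil L d 0
  | add (d : ℤ) (v w : V) : Fil L d v → Fil L d w → Fil L d (v + w)
  | smul (d : ℤ) (c : ℂ) (v : V) : Fil L d v → Fil L d (c • v)
  | mono (d d' : ℤ) (v : V) : d ≤ d' → Fil L d v → Fil L d' v
  | act (d j : ℤ) (a : g) (v : V) : j ≤ 1 → a ∈ Γ j → Fil L d v →
      Fil L (d + (3 - 2 * j)) (φ a • v)

variable (Γ χ x V) in
/-- The terms of the filtration as subspaces. -/
def fil (L d : ℤ) : Submodule ℂ V where
  carrier := {v | Fil φ Γ χ x L d v}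
  zero_mem' := .zero d
  add_mem' := .add d _ _
  smul_mem' := .smul d

variable {L : ℤ}

theorem fil_mono {d d' : ℤ} (hd : d ≤ d') : fil φ V Γ χ x L d ≤ fil φ V Γ χ x L d' :=
  fun _ hv => .mono _ _ _ hd hv

theorem act_mem_fil {d j : ℤ} {a : g} {v : V} (hj : j ≤ 1) (ha : a ∈ Γ j)
    (hv : v ∈ fil φ V Γ χ x L d) : φ a • v ∈ fil φ V Γ χ x L (d + (3 - 2 * j)) :=
  .act _ _ _ _ hj ha hv

/-- The chain sits in degrees `L k ≥ 0`, and acting raises the degree by `3 - 2 j ≥ 1`. -/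
theorem eq_zero_of_mem_fil (hL : 0 ≤ L) {d : ℤ} {v : V} (hv : v ∈ fil φ V Γ χ x L d)
    (hd : d < 0) : v = 0 := by
  induction hv with
  | of_mem_chain k v _ => exact absurd hd (not_lt.2 (mul_nonneg hL k.cast_nonneg))
  | zero => rfl
  | add d v w _ _ ihv ihw => rw [ihv hd, ihw hd, add_zero]
  | smul d c v _ ih => rw [ih hd, smul_zero]
  | mono d d' v hdd' _ ih => exact ih (by omega)
  | act d j a v hj _ _ ih => rw [ih (by omega), smul_zero]

/-- The degrees `3 - 2 j` and `1 - 2 j` are `2 (2 - j) - 1` and `2 (-j) + 1`. With `2 - j` and `-j`,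
brackets could keep the total degree; here they lower it by at least one, except for the constant
`χ([a, b])`, which occurs only for `j + i = 2`, where the total degree is `0`. -/
theorem tw_mem_fil [Fintype ι] [DecidableEq ι]
    (h : IsAdapted φ Γ χ m x z n) (hL : ∀ i, 2 * n i - 1 ≤ L) {d : ℤ} {v : V}
    (hv : v ∈ fil φ V Γ χ x L d) : ∀ (j : ℤ) (a : g), 1 ≤ j → a ∈ m → a ∈ Γ j →
    tw φ χ a • v ∈ fil φ V Γ χ x L (d + (1 - 2 * j)) := by
  induction hv with
  | of_mem_chain k v hv =>
    intro j a hj ha haj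
    cases k with
    | zero =>
      rw [(Submodule.mem_bot ℂ).1 hv, smul_zero]
      exact zero_mem _
    | succ k =>
      refine h.tw_smul_mem_of_grade φ _ ha haj fun i hi => ?_
      -- One step down the chain lowers the degree by `L`, which is at least `2 j - 1`.
      refine fil_mono φ ?_ (Fil.of_mem_chain k _ ((mem_chain_succ φ).1 hv i))
      have := hL i
      push_cast
      rw [mul_add]
      linarith
  | zero => exact fun j a _ _ _ => by rw [smul_zero]; exact zero_mem _
  | add d v w _ _ ihv ihw =>
    exact fun j a hj ha haj => by
      rw [smul_add]; exact add_mem (ihv j a hj ha haj) (ihw j a hj ha haj)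
  | smul d c v _ ih =>
    exact fun j a hj ha haj => by
      rw [smul_comm]; exact Submodule.smul_mem _ _ (ih j a hj ha haj)
  | mono d d' v hdd' _ ih =>
    exact fun j a hj ha haj => fil_mono φ (by omega) (ih j a hj ha haj)
  | act d i b v hi hb hv ih =>
    intro j a hj ha haj
    rw [smul_smul_eq_add_lie, h.lie_tw]
    have hab := h.lie_mem _ _ a haj b hb
    refine add_mem (fil_mono φ (by omega) (act_mem_fil φ hi hb (ih j a hj ha haj))) ?_
    by_cases hij : j + i ≤ 1
    · exact fil_mono φ (by omega) (act_mem_fil φ hij hab hv)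
    · have hm := h.le _ (by omega) _ hab
      have e : φ ⁅a, b⁆ • v = tw φ χ ⁅a, b⁆ • v + χ ⁅a, b⁆ • v := by
        rw [tw_apply, sub_smul, algebraMap_smul, sub_add_cancel]
      rw [e]
      refine add_mem (fil_mono φ (by omega) (ih _ _ (by omega) hm hab)) ?_
      by_cases h2 : j + i = 2
      · exact fil_mono φ (by omega) (Submodule.smul_mem _ _ hv)
      · rw [h.char_eq_zero _ h2 _ hab, zero_smul]
        exact zero_mem _

variable (Γ χ x V) in
/-- The elements of `A` that raise the degree by at most `e`. -/
def ops (L e : ℤ) : Submodule ℂ A where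
  carrier := {a | ∀ d, ∀ v ∈ fil φ V Γ χ x L d, a • v ∈ fil φ V Γ χ x L (d + e)}
  zero_mem' := fun d v _ => by rw [zero_smul]; exact zero_mem _
  add_mem' := fun ha hb d v hv => by rw [add_smul]; exact add_mem (ha d v hv) (hb d v hv)
  smul_mem' := fun c a ha d v hv => by
    rw [smul_assoc]; exact Submodule.smul_mem _ _ (ha d v hv)

theorem ops_mono {e e' : ℤ} (he : e ≤ e') : ops φ V Γ χ x L e ≤ ops φ V Γ χ x L e' :=
  fun _ ha d v hv => fil_mono φ (by omega) (ha d v hv)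

theorem mul_mem_ops {e e' : ℤ} {a b : A} (ha : a ∈ ops φ V Γ χ x L e)
    (hb : b ∈ ops φ V Γ χ x L e') : a * b ∈ ops φ V Γ χ x L (e + e') := by
  intro d v hv
  rw [mul_smul]
  exact fil_mono φ (by omega) (ha _ _ (hb d v hv))

theorem pow_mem_ops {e : ℤ} {a : A} (ha : a ∈ ops φ V Γ χ x L e) (k : ℕ) :
    a ^ k ∈ ops φ V Γ χ x L (k * e) := by
  induction k with
  | zero => intro d v hv; simpa using hv
  | succ k ih =>
    rw [pow_succ]
    exact ops_mono φ (by push_cast; linarith) (mul_mem_ops φ ih ha)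

theorem tw_mem_ops [Fintype ι] [DecidableEq ι]
    (h : IsAdapted φ Γ χ m x z n) (hL : ∀ i, 2 * n i - 1 ≤ L) (i : ι) :
    tw φ χ (x i) ∈ ops φ V Γ χ x L (-(2 * n i - 1)) := by
  intro d v hv
  exact fil_mono φ (by omega)
    (h.tw_mem_fil φ hL hv (n i) (x i) (h.one_le i) (h.x_mem i) (h.x_mem_grade i))

theorem act_mem_ops [Fintype ι] [DecidableEq ι]
    (h : IsAdapted φ Γ χ m x z n) (i : ι) :
    φ (z i) ∈ ops φ V Γ χ x L (2 * n i - 1) := by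
  intro d v hv
  have := h.one_le i
  exact fil_mono φ (by omega) (act_mem_fil φ (by omega) (h.z_mem_grade i) hv)

theorem lie_tw_tw_mem_ops [Fintype ι] [DecidableEq ι]
    (h : IsAdapted φ Γ χ m x z n) (hL : ∀ i, 2 * n i - 1 ≤ L) (i r : ι) :
    ⁅tw φ χ (x i), tw φ χ (x r)⁆ ∈
      ops φ V Γ χ x L (-(2 * n i - 1) - (2 * n r - 1) - 1) := by
  intro d v hv
  have := h.one_le i
  have := h.one_le r
  rw [h.lie_tw_tw φ (h.x_mem i) (h.x_mem r)]
  exact fil_mono φ (by omega) (h.tw_mem_fil φ hL hv (n i + n r) _ (by omega)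
    (m.lie_mem (h.x_mem i) (h.x_mem r)) (h.lie_mem _ _ _ (h.x_mem_grade i) _ (h.x_mem_grade r)))

/-- The Weyl relation up to lower degree: `x i` acts as `∂/∂z_i`. -/
theorem lie_tw_act_mem_ops [Fintype ι] [DecidableEq ι]
    (h : IsAdapted φ Γ χ m x z n) (hL : ∀ i, 2 * n i - 1 ≤ L) (i r : ι) :
    ⁅tw φ χ (x i), φ (z r)⁆ - (if i = r then 1 else 0) ∈
      ops φ V Γ χ x L ((2 * n r - 1) - (2 * n i - 1) - 1) := by
  intro d v hv
  have e : (if i = r then 1 else 0 : A) = algebraMap ℂ A (χ ⁅x i, z r⁆) := by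
    rw [h.dual]; split_ifs <;> simp
  have hab := h.lie_mem _ _ _ (h.x_mem_grade i) _ (h.z_mem_grade r)
  rw [h.lie_tw, e, ← tw_apply]
  by_cases hir : n i + (2 - n r) ≤ 1
  · rw [tw_apply, h.char_eq_zero _ (by omega) _ hab, map_zero, sub_zero]
    exact fil_mono φ (by omega) (act_mem_fil φ hir hab hv)
  · exact fil_mono φ (by omega)
      (h.tw_mem_fil φ hL hv _ _ (by omega) (h.le _ (by omega) _ hab) hab)

end IsAdapted

end Core

/-! ### Lifting invariants: a formal Poincaré lemma up to lower degree. -/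

section Core

theorem lie_mul_eq {A : Type*} [Ring A] (t a b : A) : ⁅t, a * b⁆ = ⁅t, a⁆ * b + a * ⁅t, b⁆ := by
  simp only [Ring.lie_def]; noncomm_ring

variable {g : Type*} [LieRing g] [LieAlgebra ℂ g] {A : Type*} [Ring A] [Algebra ℂ A]
  (φ : g →ₗ[ℂ] A) {V : Type*} [AddCommGroup V] [Module A V]

namespace IsAdapted

variable {Γ : ℤ → Submodule ℂ g} {χ : Module.Dual ℂ g} {m : LieSubalgebra ℂ g}
  {ι : Type*} [Fintype ι] [DecidableEq ι] {x z : ι → g} {n : ι → ℤ}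
  [Module ℂ V] [IsScalarTower ℂ A V] {L : ℤ}

theorem lie_pow_act_mem_ops (h : IsAdapted φ Γ χ m x z n) (hL : ∀ i, 2 * n i - 1 ≤ L) (i r : ι)
    (k : ℕ) : ⁅tw φ χ (x i), φ (z r) ^ (k + 1)⁆ -
        ((k + 1 : ℕ) : A) * (if i = r then 1 else 0) * φ (z r) ^ k ∈
      ops φ V Γ χ x L ((k + 1) * (2 * n r - 1) - (2 * n i - 1) - 1) := by
  induction k with
  | zero => simpa using h.lie_tw_act_mem_ops φ hL (V := V) i r
  | succ k ih =>
    set t := tw φ χ (x i)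
    set Z := φ (z r) with hZ
    have hc : ∀ b : A, (if i = r then (1 : A) else 0) * b = b * (if i = r then (1 : A) else 0) := by
      intro b; split_ifs <;> simp
    have e : ⁅t, Z ^ (k + 1 + 1)⁆ - ((k + 1 + 1 : ℕ) : A) * (if i = r then 1 else 0) * Z ^ (k + 1) =
        (⁅t, Z ^ (k + 1)⁆ - ((k + 1 : ℕ) : A) * (if i = r then 1 else 0) * Z ^ k) * Z +
          Z ^ (k + 1) * (⁅t, Z⁆ - (if i = r then 1 else 0)) := by
      rw [pow_succ Z (k + 1), lie_mul_eq, sub_mul, mul_sub, mul_assoc _ (Z ^ k) Z, ← pow_succ,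
        ← hc (Z ^ (k + 1)), Nat.cast_succ (k + 1)]
      noncomm_ring
    rw [e]
    refine add_mem (ops_mono φ ?_ (mul_mem_ops φ ih (h.act_mem_ops φ r)))
      (ops_mono φ ?_ (mul_mem_ops φ (pow_mem_ops φ (h.act_mem_ops φ r) (k + 1))
        (h.lie_tw_act_mem_ops φ hL i r)))
    · push_cast; linarith
    · push_cast; linarith

theorem lie_pow_tw_mem_ops (h : IsAdapted φ Γ χ m x z n) (hL : ∀ i, 2 * n i - 1 ≤ L) (i r : ι)
    (k : ℕ) : ⁅tw φ χ (x i), tw φ χ (x r) ^ k⁆ ∈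
      ops φ V Γ χ x L (-(k * (2 * n r - 1)) - (2 * n i - 1) - 1) := by
  induction k with
  | zero => simp [Ring.lie_def]
  | succ k ih =>
    rw [pow_succ, lie_mul_eq]
    refine add_mem (ops_mono φ ?_ (mul_mem_ops φ ih (h.tw_mem_ops φ hL r)))
      (ops_mono φ ?_ (mul_mem_ops φ (pow_mem_ops φ (h.tw_mem_ops φ hL r) k)
        (h.lie_tw_tw_mem_ops φ hL i r)))
    · push_cast; linarith
    · push_cast; linarith

theorem pow_mul_pow_mem_ops (h : IsAdapted φ Γ χ m x z n) (hL : ∀ i, 2 * n i - 1 ≤ L) (r : ι)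
    (k : ℕ) : φ (z r) ^ (k + 1) * tw φ χ (x r) ^ k ∈ ops φ V Γ χ x L (2 * n r - 1) :=
  ops_mono φ (by push_cast; linarith) (mul_mem_ops φ (pow_mem_ops φ (h.act_mem_ops φ r) (k + 1))
    (pow_mem_ops φ (h.tw_mem_ops φ hL r) k))

theorem lie_pow_mul_pow_mem_ops (h : IsAdapted φ Γ χ m x z n) (hL : ∀ i, 2 * n i - 1 ≤ L)
    (i r : ι) (k : ℕ) : ⁅tw φ χ (x i), φ (z r) ^ (k + 1) * tw φ χ (x r) ^ k⁆ -
        ((k + 1 : ℕ) : A) * (if i = r then 1 else 0) * (φ (z r) ^ k * tw φ χ (x r) ^ k) ∈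
      ops φ V Γ χ x L ((2 * n r - 1) - (2 * n i - 1) - 1) := by
  rw [lie_mul_eq, add_sub_right_comm, ← mul_assoc, ← sub_mul]
  refine add_mem (ops_mono φ ?_ (mul_mem_ops φ (h.lie_pow_act_mem_ops φ hL i r k)
      (pow_mem_ops φ (h.tw_mem_ops φ hL r) k)))
    (ops_mono φ ?_ (mul_mem_ops φ (pow_mem_ops φ (h.act_mem_ops φ r) (k + 1))
      (h.lie_pow_tw_mem_ops φ hL i r k)))
  · linarith
  · push_cast; linarith

/-- An approximate solution `w` of `t w = u`, where `t = φ(x r) - χ(x r)`, for a vector `u`. -/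
theorem exists_approx (h : IsAdapted φ Γ χ m x z n) (hL₀ : 0 ≤ L) (hL : ∀ i, 2 * n i - 1 ≤ L)
    (K : Submodule A V) (r : ι) {d : ℤ} {u : V} (hu : u ∈ K)
    (hud : u ∈ fil φ V Γ χ x L (d - (2 * n r - 1))) :
    ∃ w ∈ K, w ∈ fil φ V Γ χ x L d ∧
      tw φ χ (x r) • w - u ∈ fil φ V Γ χ x L (d - (2 * n r - 1) - 1) ∧
      ∀ i, i ≠ r → tw φ χ (x i) • u ∈ fil φ V Γ χ x L (d - (2 * n i - 1) - 1 - (2 * n r - 1)) →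
        tw φ χ (x i) • w ∈ fil φ V Γ χ x L (d - (2 * n i - 1) - 1) := by
  set Z := φ (z r)
  set t := tw φ χ (x r)
  -- Formal integration: if `[t, Z] = 1`, then `∑ c k Z ^ (k + 1) t ^ k` is a right inverse of `t`
  -- on vectors killed by a power of `t`, because the terms telescope.
  let c (k : ℕ) : ℂ := (-1) ^ k / (k + 1).factorial
  obtain ⟨N, hN⟩ : ∃ N : ℕ, t ^ N • u = 0 := by
    -- Each `t` lowers the degree by at least `1`, and `u` has degree below `d`.
    refine ⟨d.toNat, eq_zero_of_mem_fil φ hL₀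
      (pow_mem_ops φ (h.tw_mem_ops φ hL r) d.toNat _ _ hud) ?_⟩
    have := h.one_le r
    nlinarith [Int.self_le_toNat d, Int.natCast_nonneg d.toNat]
  let w : V := ∑ k ∈ Finset.range N, c k • (Z ^ (k + 1) * t ^ k) • u
  have hpow (k : ℕ) := h.pow_mul_pow_mem_ops φ hL (V := V) r k
  have hw (i : ι) : tw φ χ (x i) • w -
      ∑ k ∈ Finset.range N, (c k • (Z ^ (k + 1) * t ^ k) • tw φ χ (x i) • u +
        c k • (((k + 1 : ℕ) : A) * (if i = r then 1 else 0) * (Z ^ k * t ^ k)) • u) ∈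
      fil φ V Γ χ x L (d - (2 * n i - 1) - 1) := by
    rw [Finset.smul_sum, ← Finset.sum_sub_distrib]
    refine sum_mem fun k _ => ?_
    have := h.lie_pow_mul_pow_mem_ops φ hL (V := V) i r k _ _ hud
    rw [smul_comm (tw φ χ (x i)) (c k), smul_smul_eq_add_lie (tw φ χ (x i)), smul_add,
      add_sub_add_left_eq_sub, ← smul_sub, ← sub_smul]
    exact Submodule.smul_mem _ _ (fil_mono φ (by omega) this)
  refine ⟨w, ?_, ?_, ?_, ?_⟩
  · refine sum_mem fun k _ => ?_
    rw [← smul_assoc]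
    exact K.smul_mem _ hu
  · exact sum_mem fun k _ => Submodule.smul_mem _ _ (fil_mono φ (by omega) (hpow k _ _ hud))
  · have key : ∑ k ∈ Finset.range N, (c k • (Z ^ (k + 1) * t ^ k) • t • u +
        c k • (((k + 1 : ℕ) : A) * (if r = r then 1 else 0) * (Z ^ k * t ^ k)) • u) = u := by
      -- The sum telescopes to `b 0 - b N`, with `b 0 = u` and `b N = 0`.
      let b (k : ℕ) : V := ((-1) ^ k / k.factorial : ℂ) • (Z ^ k * t ^ k) • u
      have hb (k : ℕ) : c k • (Z ^ (k + 1) * t ^ k) • t • u +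
          c k • (((k + 1 : ℕ) : A) * (if r = r then 1 else 0) * (Z ^ k * t ^ k)) • u =
          b k - b (k + 1) := by
        have e₁ : c k • (Z ^ (k + 1) * t ^ k) • t • u = - b (k + 1) := by
          rw [← mul_smul, mul_assoc, ← pow_succ, ← neg_smul]
          congr 1
          simp only [c]
          rw [pow_succ]
          ring
        have e₂ : c k • (((k + 1 : ℕ) : A) * (if r = r then 1 else 0) * (Z ^ k * t ^ k)) • u =
            b k := by
          rw [if_pos rfl, mul_one, mul_smul, Nat.cast_smul_eq_nsmul A,
            ← Nat.cast_smul_eq_nsmul ℂ, smul_smul]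
          congr 1
          simp only [c]
          rw [Nat.factorial_succ]
          have : ((k + 1 : ℕ) : ℂ) ≠ 0 := Nat.cast_ne_zero.2 k.succ_ne_zero
          have : (k.factorial : ℂ) ≠ 0 := Nat.cast_ne_zero.2 k.factorial_ne_zero
          rw [Nat.cast_mul]
          field_simp
        rw [e₁, e₂, neg_add_eq_sub]
      rw [Finset.sum_congr rfl fun k _ => hb k, Finset.sum_range_sub']
      simp only [b]
      rw [mul_smul _ (t ^ N), hN]
      simp
    have := hw r
    rwa [key] at this
  · intro i hi hiu
    have := hw i
    simp only [if_neg hi, mul_zero, zero_mul, zero_smul, smul_zero, add_zero] at this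
    have h2 : ∑ k ∈ Finset.range N, c k • (Z ^ (k + 1) * t ^ k) • tw φ χ (x i) • u ∈
        fil φ V Γ χ x L (d - (2 * n i - 1) - 1) :=
      sum_mem fun k _ => Submodule.smul_mem _ _ (fil_mono φ (by omega) (hpow k _ _ hiu))
    simpa using add_mem this h2

/-- Indices are corrected one by one. Correcting `r` does not spoil an earlier `i` because of the
cocycle condition: the actions of `x i` and `x r` on `v - w` commute up to that of `[x i, x r]`,
whose degree is one lower. -/
theorem exists_improve (h : IsAdapted φ Γ χ m x z n) (hL₀ : 0 ≤ L) (hL : ∀ i, 2 * n i - 1 ≤ L)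
    (K : Submodule A V) {d : ℤ} {v : V} (hvK : ∀ i, tw φ χ (x i) • v ∈ K)
    (hv : ∀ i, tw φ χ (x i) • v ∈ fil φ V Γ χ x L (d - (2 * n i - 1))) (s : Finset ι) :
    ∃ w ∈ K, (∀ i, tw φ χ (x i) • (v - w) ∈ fil φ V Γ χ x L (d - (2 * n i - 1))) ∧
      ∀ i ∈ s, tw φ χ (x i) • (v - w) ∈ fil φ V Γ χ x L (d - (2 * n i - 1) - 1) := by
  induction s using Finset.induction_on with
  | empty => exact ⟨0, zero_mem _, by simpa using hv, fun i hi => absurd hi (Finset.notMem_empty i)⟩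
  | insert r s hr ih =>
    obtain ⟨w, hw, hwd, hws⟩ := ih
    obtain ⟨w', hw', hwd', hr', hi'⟩ := h.exists_approx φ hL₀ hL K r (d := d)
      (u := tw φ χ (x r) • (v - w))
      (by rw [smul_sub]; exact sub_mem (hvK r) (K.smul_mem _ hw)) (hwd r)
    refine ⟨w + w', add_mem hw hw', fun i => ?_, fun i hi => ?_⟩
    · rw [← sub_sub, smul_sub]
      exact sub_mem (hwd i) (fil_mono φ (by omega) (h.tw_mem_ops φ hL i _ _ hwd'))
    · rw [← sub_sub, smul_sub]
      by_cases hir : i = r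
      · subst hir
        rw [← neg_sub (_ • w')]
        exact neg_mem hr'
      · have his : i ∈ s := (Finset.mem_insert.1 hi).resolve_left hir
        refine sub_mem (hws i his) (hi' i hir ?_)
        rw [smul_smul_eq_add_lie, h.lie_tw_tw φ (h.x_mem i) (h.x_mem r)]
        refine add_mem (fil_mono φ (by omega) (h.tw_mem_ops φ hL r _ _ (hws i his))) ?_
        refine h.tw_smul_mem_of_grade φ _ (m.lie_mem (h.x_mem i) (h.x_mem r))
          (h.lie_mem _ _ _ (h.x_mem_grade i) _ (h.x_mem_grade r)) fun k hk => ?_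
        exact fil_mono φ (by omega) (hwd k)

/-- The cocycle `y ↦ (y - χ(y)) v` with values in `K` is a coboundary: each use of `exists_improve`
lowers the bound `D` by one, and at `D = 0` every image has negative degree. -/
theorem exists_sub_eq_zero (h : IsAdapted φ Γ χ m x z n)
    (hV : ∀ a ∈ m, ∀ v : V, v ∈ nilVectors (tw φ χ a) V) (K : Submodule A V) (v : V)
    (hv : ∀ i, tw φ χ (x i) • v ∈ K) : ∃ w ∈ K, ∀ i, tw φ χ (x i) • (v - w) = 0 := by
  obtain ⟨L, hL₀, hL⟩ : ∃ L : ℤ, 0 ≤ L ∧ ∀ i, 2 * n i - 1 ≤ L := by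
    have h0 (i : ι) : 0 ≤ 2 * n i - 1 := by have := h.one_le i; omega
    exact ⟨∑ i, (2 * n i - 1), Finset.sum_nonneg fun i _ => h0 i, fun i =>
      Finset.single_le_sum (f := fun i => 2 * n i - 1) (fun i _ => h0 i) (Finset.mem_univ i)⟩
  have main (D : ℕ) : ∀ v : V, (∀ i, tw φ χ (x i) • v ∈ K) →
      (∀ i, tw φ χ (x i) • v ∈ fil φ V Γ χ x L (D - (2 * n i - 1))) →
      ∃ w ∈ K, ∀ i, tw φ χ (x i) • (v - w) = 0 := by
    induction D with
    | zero =>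
      intro v _ hv
      refine ⟨0, zero_mem _, fun i => eq_zero_of_mem_fil φ hL₀ (by simpa using hv i) ?_⟩
      have := h.one_le i
      omega
    | succ D ih =>
      intro v hvK hv
      obtain ⟨w, hw, -, hws⟩ := h.exists_improve φ hL₀ hL K hvK hv Finset.univ
      obtain ⟨w', hw', h0⟩ := ih (v - w)
        (fun i => by rw [smul_sub]; exact sub_mem (hvK i) (K.smul_mem _ hw))
        fun i => fil_mono φ (by push_cast; omega) (hws i (Finset.mem_univ i))
      exact ⟨w + w', add_mem hw hw', fun i => by rw [← sub_sub]; exact h0 i⟩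
  obtain ⟨k, hk⟩ := h.exists_mem_chain φ hV v
  refine main (L * k).toNat v hv fun i => ?_
  refine fil_mono φ ?_ (h.tw_mem_ops φ hL i _ _ (Fil.of_mem_chain (Γ := Γ) (L := L) k v hk))
  have := Int.self_le_toNat (L * k)
  linarith

theorem exists_ne_zero (h : IsAdapted φ Γ χ m x z n)
    (hV : ∀ a ∈ m, ∀ v : V, v ∈ nilVectors (tw φ χ a) V) {v : V} (hv : v ≠ 0) :
    ∃ w : V, w ≠ 0 ∧ ∀ a ∈ m, tw φ χ a • w = 0 := by
  obtain ⟨w, hw, hw'⟩ := h.exists_notMem φ hV ⊥ (fun i v hv => by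
    rw [(Submodule.mem_bot ℂ).1 hv, smul_zero]; exact zero_mem _)
    (fun hv' => hv ((Submodule.mem_bot ℂ).1 hv'))
  exact ⟨w, fun h0 => hw (h0 ▸ zero_mem _), fun a ha =>
    (Submodule.mem_bot ℂ).1 (h.tw_smul_mem φ ⊥ ha hw')⟩

end IsAdapted

end Core

/-! ### Good gradings -/

section GoodGrading

variable {g : Type u} [LieRing g] [LieAlgebra ℂ g]

section LieStructure

attribute [local instance] LieRing.ofAssociativeRing

variable (g) in
/-- The canonical linear map from `g` to `U(g)`. -/
def ιLin : g →ₗ[ℂ] UniversalEnvelopingAlgebra ℂ g :=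
  (UniversalEnvelopingAlgebra.ι (L := g) ℂ).toLinearMap

/-- Written with products, so as not to depend on the Lie ring structure of `U(g)` that is a local
instance here. -/
theorem ιLin_lie_eq_sub (a b : g) :
    ιLin g ⁅a, b⁆ = ιLin g a * ιLin g b - ιLin g b * ιLin g a :=
  LieHom.map_lie (UniversalEnvelopingAlgebra.ι ℂ) a b

end LieStructure

theorem ιLin_apply (a : g) : ιLin g a = UniversalEnvelopingAlgebra.ι ℂ a :=
  rfl

theorem ιLin_lie (a b : g) : ιLin g ⁅a, b⁆ = ⁅ιLin g a, ιLin g b⁆ := by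
  rw [Ring.lie_def, ιLin_lie_eq_sub]

/-- The enveloping algebra is generated by the Lie algebra. -/
theorem envelopingAlgebra_induction {p : UniversalEnvelopingAlgebra ℂ g → Prop}
    (algebraMap : ∀ c, p (algebraMap ℂ _ c)) (ι : ∀ a : g, p (ιLin g a))
    (mul : ∀ x y, p x → p y → p (x * y)) (add : ∀ x y, p x → p y → p (x + y))
    (x : UniversalEnvelopingAlgebra ℂ g) : p x := by
  obtain ⟨y, rfl⟩ : ∃ y, UniversalEnvelopingAlgebra.mkAlgHom ℂ g y = x :=
    RingCon.mkₐ_surjective _ x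
  induction y using TensorAlgebra.induction with
  | algebraMap c => rw [AlgHom.commutes]; exact algebraMap c
  | ι a => exact ι a
  | mul x y hx hy => rw [map_mul]; exact mul _ _ hx hy
  | add x y hx hy => rw [map_add]; exact add _ _ hx hy

/-- Invariance under `q` gives `(i + j) B(a, b) = 0`. -/
theorem bilin_eq_zero_of_grade {B : LinearMap.BilinForm ℂ g} (hB : B.lieInvariant g)
    {Γ : ℤ → Submodule ℂ g} {q : g} (hq : IsGradingElement q Γ) {i j : ℤ} (hij : i + j ≠ 0)
    {a b : g} (ha : a ∈ Γ i) (hb : b ∈ Γ j) : B a b = 0 := by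
  have h := hB q a b
  rw [(hq i a).1 ha, (hq j b).1 hb, map_smul, map_smul, LinearMap.smul_apply, smul_eq_mul,
    smul_eq_mul, eq_neg_iff_add_eq_zero, ← add_mul] at h
  exact (mul_eq_zero.1 h).resolve_left (by exact_mod_cast hij)

/-- The homogeneous elements that span a good algebra. -/
def goodSet (Γ : ℤ → Submodule ℂ g) (l : Submodule ℂ g) : Set g :=
  {a | a ∈ l ∨ ∃ i, 2 ≤ i ∧ a ∈ Γ i}

theorem span_goodSet (Γ : ℤ → Submodule ℂ g) (l : Submodule ℂ g) :
    Submodule.span ℂ (goodSet Γ l) = l ⊔ ⨆ (i : ℤ) (_ : 2 ≤ i), Γ i := by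
  refine le_antisymm (Submodule.span_le.2 ?_) (sup_le ?_ (iSup₂_le fun i hi => ?_))
  · rintro a (ha | ⟨i, hi, ha⟩)
    · exact Submodule.mem_sup_left ha
    · exact Submodule.mem_sup_right (Submodule.mem_iSup_of_mem i (Submodule.mem_iSup_of_mem hi ha))
  · exact fun a ha => Submodule.subset_span (Or.inl ha)
  · exact fun a ha => Submodule.subset_span (Or.inr ⟨i, hi, ha⟩)

/-- Reduces questions on `m` to homogeneous elements. Pairs from `l` are handled by isotropy; all
others have total degree at least `3`, out of reach of `χ`. -/
theorem IsGoodAlgebra.exists_span {Γ : ℤ → Submodule ℂ g} {χ : Module.Dual ℂ g}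
    {m : LieSubalgebra ℂ g} (hm : IsGoodAlgebra Γ χ m) :
    ∃ s : Set g, Submodule.span ℂ s = m.toSubmodule ∧ (∀ a ∈ s, ∃ i, 1 ≤ i ∧ a ∈ Γ i) ∧
      (∀ i, 2 ≤ i → ∀ a ∈ Γ i, a ∈ m) ∧
      ∀ a ∈ s, ∀ b ∈ s, χ ⁅a, b⁆ = 0 ∨ ∃ i j, 3 ≤ i + j ∧ a ∈ Γ i ∧ b ∈ Γ j := by
  obtain ⟨l, hl, hml⟩ := hm
  rw [← span_goodSet] at hml
  have hl₁ {a : g} (ha : a ∈ l) : a ∈ Γ 1 := ((hl a).1 ha).1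
  refine ⟨goodSet Γ l, hml.symm, ?_, ?_, ?_⟩
  · rintro a (ha | ⟨i, hi, ha⟩)
    · exact ⟨1, le_rfl, hl₁ ha⟩
    · exact ⟨i, by omega, ha⟩
  · intro i hi a ha
    rw [← LieSubalgebra.mem_toSubmodule, hml]
    exact Submodule.subset_span (Or.inr ⟨i, hi, ha⟩)
  · rintro a (ha | ⟨i, hi, ha⟩) b (hb | ⟨j, hj, hb⟩)
    · exact Or.inl (((hl a).1 ha).2 b hb)
    · exact Or.inr ⟨1, j, by omega, hl₁ ha, hb⟩
    · exact Or.inr ⟨i, 1, by omega, ha, hl₁ hb⟩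
    · exact Or.inr ⟨i, j, by omega, ha, hb⟩

/-- Data for a good algebra: the grading is good for `f`, it is defined by `q`, and `m` is a good
algebra for the linear form `B f`. -/
structure GoodData (B : LinearMap.BilinForm ℂ g) (f q : g) (Γ : ℤ → Submodule ℂ g)
    (m : LieSubalgebra ℂ g) : Prop where
  invariant : B.lieInvariant g
  nondegenerate : B.Nondegenerate
  symm : B.IsSymm
  grading : IsGoodGrading Γ f
  element : IsGradingElement q Γ
  good : IsGoodAlgebra Γ (B f) m

namespace GoodData

variable {B : LinearMap.BilinForm ℂ g} {f q : g} {Γ : ℤ → Submodule ℂ g}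
  {m : LieSubalgebra ℂ g}

theorem char_eq_zero (h : GoodData B f q Γ m) {i : ℤ} (hi : i ≠ 2) {a : g} (ha : a ∈ Γ i) :
    B f a = 0 :=
  bilin_eq_zero_of_grade h.invariant h.element (by omega) h.grading.mem ha

theorem char_lie (h : GoodData B f q Γ m) {a b : g} (ha : a ∈ m) (hb : b ∈ m) :
    B f ⁅a, b⁆ = 0 := by
  obtain ⟨s, hs, -, -, hχ⟩ := h.good.exists_span
  rw [← LieSubalgebra.mem_toSubmodule, ← hs] at ha hb
  induction ha using Submodule.span_induction with
  | zero => rw [zero_lie, map_zero]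
  | add x y _ _ hx hy => rw [add_lie, map_add, hx, hy, add_zero]
  | smul c x _ hx => rw [smul_lie, map_smul, hx, smul_zero]
  | mem a ha =>
    induction hb using Submodule.span_induction with
    | zero => rw [lie_zero, map_zero]
    | add x y _ _ hx hy => rw [lie_add, map_add, hx, hy, add_zero]
    | smul c x _ hx => rw [lie_smul, map_smul, hx, smul_zero]
    | mem b hb =>
      rcases hχ a ha b hb with h0 | ⟨i, j, hij, hai, hbj⟩
      · exact h0
      · exact h.char_eq_zero (by omega) (h.grading.lie_mem i j a hai b hbj)

theorem char_lie_eq (h : GoodData B f q Γ m) (a b : g) : B f ⁅a, b⁆ = B ⁅f, a⁆ b := by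
  have := h.invariant a f b
  rw [← lie_skew, map_neg, LinearMap.neg_apply, neg_inj] at this
  exact this.symm

/-- The projections to the homogeneous components. -/
theorem exists_components (h : GoodData B f q Γ m) : ∃ p : ℤ → g →ₗ[ℂ] g,
    (∀ i a, p i a ∈ Γ i) ∧ (∀ i, ∀ a ∈ Γ i, p i a = a) ∧
    (∀ i j, i ≠ j → ∀ a ∈ Γ j, p i a = 0) ∧ ∀ a, (∀ i, p i a = 0) → a = 0 := by
  classical
  let := h.grading.isInternal.chooseDecomposition
  refine ⟨fun i => (Γ i).subtype ∘ₗ DirectSum.component ℂ ℤ (fun i => Γ i) i ∘ₗ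
    (DirectSum.decomposeLinearEquiv Γ).toLinearMap, fun i a => Subtype.coe_prop _,
    fun i a ha => DirectSum.decompose_of_mem_same Γ ha,
    fun i j hij a ha => DirectSum.decompose_of_mem_ne Γ ha hij.symm, fun a ha => ?_⟩
  apply (DirectSum.decompose Γ).injective
  rw [DirectSum.decompose_zero]
  refine DFinsupp.ext fun i => Subtype.ext (ha i)

theorem iSup_eq_top (h : GoodData B f q Γ m) : ⨆ i, Γ i = ⊤ :=
  h.grading.isInternal.submodule_iSup_eq_top

/-- `ad f` shifts homogeneous components by `-2` and is injective in degrees `≥ 1`, where `m` lives.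
-/
theorem eq_zero_of_lie_eq_zero (h : GoodData B f q Γ m) {a : g} (ha : a ∈ m) (hfa : ⁅f, a⁆ = 0) :
    a = 0 := by
  obtain ⟨p, hp, hps, hpn, hp0⟩ := h.exists_components
  have hcomm (i : ℤ) (a : g) : p (i - 2) ⁅f, a⁆ = ⁅f, p i a⁆ := by
    have ha : a ∈ ⨆ i, Γ i := h.iSup_eq_top ▸ Submodule.mem_top
    induction ha using Submodule.iSup_induction' with
    | zero => rw [lie_zero, map_zero, map_zero, lie_zero]
    | add x y _ _ hx hy => rw [lie_add, map_add, map_add, lie_add, hx, hy]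
    | mem j a ha =>
      have hfa := h.grading.lie_mem _ _ f h.grading.mem a ha
      by_cases hij : i = j
      · subst hij
        rw [hps i a ha, hps _ _ (by rwa [neg_add_eq_sub] at hfa)]
      · rw [hpn i j hij a ha, hpn _ _ (by omega) _ hfa, lie_zero]
  refine hp0 a fun i => ?_
  by_cases hi : 1 ≤ i
  · exact h.grading.injective i hi _ (hp i a) (by rw [← hcomm, hfa, map_zero])
  · obtain ⟨s, hs, hs₁, -, -⟩ := h.good.exists_span
    rw [← LieSubalgebra.mem_toSubmodule, ← hs] at ha
    clear hfa
    induction ha using Submodule.span_induction with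
    | zero => exact map_zero _
    | add x y _ _ hx hy => rw [map_add, hx, hy, add_zero]
    | smul c x _ hx => rw [map_smul, hx, smul_zero]
    | mem a ha =>
      obtain ⟨j, hj, haj⟩ := hs₁ a ha
      exact hpn i j (by omega) a haj

/-- For a homogeneous basis `x i` of `m` the `[f, x i]` are independent, so nondegeneracy gives dual
vectors for `χ([x, w]) = ([f, x] | w)`. As `χ` lives in degree `2`, they may be replaced by their
components of degree `2 - n i`. -/
theorem exists_isAdapted [FiniteDimensional ℂ g] (h : GoodData B f q Γ m) :
    ∃ (k : ℕ) (x z : Fin k → g) (n : Fin k → ℤ),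
      IsAdapted (ιLin g) Γ (B f) m x z n := by
  obtain ⟨s, hs, hs₁, hle, -⟩ := h.good.exists_span
  obtain ⟨b, hbs, hspan, hli⟩ := exists_linearIndependent ℂ s
  have hfin : Finite b := hli.finite
  obtain ⟨k, ⟨e⟩⟩ := Finite.exists_equiv_fin b
  let x : Fin k → g := fun i => (e.symm i : g)
  have hx : LinearIndependent ℂ x := hli.comp e.symm e.symm.injective
  have hrange : Submodule.span ℂ (Set.range x) = m.toSubmodule := by
    rw [← hs, ← hspan]
    congr 1
    rw [show x = (Subtype.val : b → g) ∘ e.symm from rfl, e.symm.surjective.range_comp,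
      Subtype.range_val]
  have hxm (i : Fin k) : x i ∈ m := by
    rw [← LieSubalgebra.mem_toSubmodule, ← hrange]
    exact Submodule.subset_span ⟨i, rfl⟩
  choose n hn hxn using fun i => hs₁ (x i) (hbs (e.symm i).2)
  obtain ⟨p, hp, hps, hpn, -⟩ := h.exists_components
  have hfx : LinearIndependent ℂ fun i => ⁅f, x i⁆ := by
    refine hx.map (f := (LieAlgebra.ad ℂ g f : g →ₗ[ℂ] g)) ?_
    rw [hrange, Submodule.disjoint_def]
    exact fun a ha hfa => h.eq_zero_of_lie_eq_zero ha hfa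
  have hw (i : Fin k) : ∃ w, ∀ j, B f ⁅x j, w⁆ = if j = i then 1 else 0 := by
    obtain ⟨lam, hlam⟩ := LinearMap.exists_extend ((Module.Basis.span hfx).coord i)
    refine ⟨(B.toDual h.nondegenerate).symm lam, fun j => ?_⟩
    have hb : (⟨⁅f, x j⁆, Submodule.subset_span ⟨j, rfl⟩⟩ :
        Submodule.span ℂ (Set.range fun i => ⁅f, x i⁆)) = Module.Basis.span hfx j :=
      (Module.Basis.span_apply hfx j).symm
    rw [h.char_lie_eq, h.symm.eq, LinearMap.BilinForm.apply_toDual_symm_apply]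
    have := LinearMap.congr_fun hlam (Module.Basis.span hfx j)
    rw [← hb] at this
    refine this.trans ?_
    rw [hb, Module.Basis.coord_apply, Module.Basis.repr_self, Finsupp.single_apply]
  choose w hw using hw
  have hcomp (j : Fin k) (v : g) : B f ⁅x j, p (2 - n j) v⁆ = B f ⁅x j, v⁆ := by
    have hv : v ∈ ⨆ i, Γ i := h.iSup_eq_top ▸ Submodule.mem_top
    induction hv using Submodule.iSup_induction' with
    | zero => rw [map_zero]
    | add x y _ _ hx hy => rw [map_add, lie_add, lie_add, map_add, map_add, hx, hy]
    | mem i a ha =>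
      by_cases hij : 2 - n j = i
      · rw [hps _ _ (hij ▸ ha)]
      · rw [hpn _ _ hij _ ha, lie_zero, map_zero,
          h.char_eq_zero _ (h.grading.lie_mem _ _ _ (hxn j) _ ha)]
        omega
  have hdual (i j : Fin k) : B f ⁅x i, p (2 - n j) (w j)⁆ = if i = j then 1 else 0 := by
    by_cases hij : n i = n j
    · rw [← hij, hcomp, hw]
    · rw [if_neg (fun h => hij (congrArg n h)),
        h.char_eq_zero _ (h.grading.lie_mem _ _ _ (hxn i) _ (hp _ _))]
      omega
  refine ⟨k, x, fun i => p (2 - n i) (w i), n, ιLin_lie, h.grading.lie_mem, hle,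
    fun a ha b hb => h.char_lie ha hb, fun i hi a ha => h.char_eq_zero hi ha, hxm, hxn, hn,
    fun i => hp _ _, fun a ha => ?_, hdual⟩
  · rw [← LieSubalgebra.mem_toSubmodule, ← hrange] at ha
    induction ha using Submodule.span_induction with
    | zero => simp
    | add a b _ _ ha hb =>
      simp only [add_lie, map_add, add_smul, Finset.sum_add_distrib]
      rw [← ha, ← hb]
    | smul c a _ ha =>
      simp only [smul_lie, map_smul, smul_assoc, ← Finset.smul_sum]
      rw [← ha]
    | mem a ha =>
      obtain ⟨i, rfl⟩ := ha
      simp [hdual]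

end GoodData

end GoodGrading

/-! ### Shifted good algebras: the generator property and the two stages. -/

section GoodGrading

variable {g : Type u} [LieRing g] [LieAlgebra ℂ g]

theorem mem_shift_iff {χ : Module.Dual ℂ g} {m : LieSubalgebra ℂ g}
    {t : UniversalEnvelopingAlgebra ℂ g} : t ∈ shift χ m ↔ ∃ a ∈ m, tw (ιLin g) χ a = t :=
  ⟨fun ⟨a, ha⟩ => ⟨a.1, a.2, ha⟩, fun ⟨a, ha, hat⟩ => ⟨⟨a, ha⟩, hat⟩⟩

theorem tw_mem_shift {χ : Module.Dual ℂ g} {m : LieSubalgebra ℂ g} {a : g} (ha : a ∈ m) :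
    tw (ιLin g) χ a ∈ shift χ m :=
  mem_shift_iff.2 ⟨a, ha, rfl⟩

theorem lie_tw_ιLin (χ : Module.Dual ℂ g) (a b : g) :
    ⁅tw (ιLin g) χ a, ιLin g b⁆ = ιLin g ⁅a, b⁆ := by
  rw [tw_apply, ιLin_lie, Ring.lie_def, Ring.lie_def, sub_mul, mul_sub, Algebra.commutes,
    sub_sub_sub_cancel_right]

theorem iterate_lie_tw (χ : Module.Dual ℂ g) (a : g) (k : ℕ) (b : g) :
    (fun y => ⁅tw (ιLin g) χ a, y⁆)^[k] (ιLin g b) = ιLin g ((LieAlgebra.ad ℂ g a ^ k) b) := by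
  induction k with
  | zero => rfl
  | succ k ih =>
    rw [Function.iterate_succ_apply', ih, lie_tw_ιLin, pow_succ', Module.End.mul_apply,
      LieAlgebra.ad_apply]

/-- If `ad a` is locally nilpotent on `g`, then the vectors killed by a power of `a - χ(a)` form a
`U(g)`-submodule. -/
theorem smul_mem_nilVectors_tw {V : Type*} [AddCommGroup V]
    [Module (UniversalEnvelopingAlgebra ℂ g) V] (χ : Module.Dual ℂ g) {a : g}
    (ha : ∀ b : g, b ∈ nilVectors (LieAlgebra.ad ℂ g a : Module.End ℂ g) g) {v : V}
    (hv : v ∈ nilVectors (tw (ιLin g) χ a) V) (y : UniversalEnvelopingAlgebra ℂ g) :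
    y • v ∈ nilVectors (tw (ιLin g) χ a) V := by
  induction y using envelopingAlgebra_induction generalizing v with
  | algebraMap c =>
    obtain ⟨n, hn⟩ := hv
    exact ⟨n, by rw [← mul_smul, ← Algebra.commutes, mul_smul, hn, smul_zero]⟩
  | ι b =>
    obtain ⟨k, hk⟩ := ha b
    obtain ⟨n, hn⟩ := hv
    refine ⟨n + k, pow_smul_smul_eq_zero k n _ _ ?_ hn⟩
    rw [iterate_lie_tw]
    exact (congrArg (ιLin g) hk).trans (map_zero _)
  | mul x y hx hy => rw [mul_smul]; exact hx (hy hv)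
  | add x y hx hy => rw [add_smul]; exact add_mem (hx hv) (hy hv)

namespace GoodData

variable {B : LinearMap.BilinForm ℂ g} {f q : g} {Γ : ℤ → Submodule ℂ g}
  {m : LieSubalgebra ℂ g}

/-- `ad a` strictly raises degrees, and only finitely many components are nonzero. -/
theorem mem_nilVectors_ad [FiniteDimensional ℂ g] (h : GoodData B f q Γ m) {a : g} (ha : a ∈ m)
    (b : g) : b ∈ nilVectors (LieAlgebra.ad ℂ g a : Module.End ℂ g) g := by
  obtain ⟨J, hJ⟩ : ∃ J : ℤ, ∀ i, J ≤ i → Γ i = ⊥ := by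
    have hfin := WellFoundedGT.finite_ne_bot_of_iSupIndep
      h.grading.isInternal.submodule_iSupIndep
    obtain ⟨J, hJ⟩ := hfin.bddAbove
    refine ⟨J + 1, fun i hi => ?_⟩
    by_contra hne
    have := hJ hne
    omega
  let G (j : ℤ) : Submodule ℂ g := ⨆ (i : ℤ) (_ : j ≤ i), Γ i
  have hG (j : ℤ) (hj : J ≤ j) : G j = ⊥ := by
    simp only [G, iSup_eq_bot]
    exact fun i hi => hJ i (hj.trans hi)
  have hle {i j : ℤ} (hij : j ≤ i) : Γ i ≤ G j := le_iSup₂_of_le i hij le_rfl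
  obtain ⟨s, hs, hs₁, -, -⟩ := h.good.exists_span
  have hstep (j : ℤ) : G j ≤ (G (j + 1)).comap (LieAlgebra.ad ℂ g a : g →ₗ[ℂ] g) := by
    refine iSup₂_le fun i hi b hb => ?_
    rw [← LieSubalgebra.mem_toSubmodule, ← hs] at ha
    rw [Submodule.mem_comap, LieAlgebra.ad_apply]
    induction ha using Submodule.span_induction with
    | zero => rw [zero_lie]; exact zero_mem _
    | add x y _ _ hx hy => rw [add_lie]; exact add_mem hx hy
    | smul c x _ hx => rw [smul_lie]; exact Submodule.smul_mem _ _ hx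
    | mem a ha =>
      obtain ⟨k, hk, hak⟩ := hs₁ a ha
      exact hle (by omega) (h.grading.lie_mem k i a hak b hb)
  have hb : b ∈ ⨆ i, Γ i := h.iSup_eq_top ▸ Submodule.mem_top
  induction hb using Submodule.iSup_induction' with
  | zero => exact zero_mem _
  | add x y _ _ hx hy => exact add_mem hx hy
  | mem j b hb =>
    have hk (k : ℕ) : (LieAlgebra.ad ℂ g a ^ k : Module.End ℂ g) b ∈ G (j + k) := by
      induction k with
      | zero => exact hle (by simp) hb
      | succ k ih =>
        rw [pow_succ', Module.End.mul_apply]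
        have := hstep _ ih
        rwa [Submodule.mem_comap, add_assoc, ← Nat.cast_succ] at this
    refine ⟨(J - j).toNat, ?_⟩
    have := hk (J - j).toNat
    rw [hG _ (by omega)] at this
    exact (Submodule.mem_bot ℂ).1 this

theorem smul_mem_nilVectors [FiniteDimensional ℂ g] (h : GoodData B f q Γ m) {V : Type*}
    [AddCommGroup V] [Module (UniversalEnvelopingAlgebra ℂ g) V]
    {t : UniversalEnvelopingAlgebra ℂ g} (ht : t ∈ shift (B f) m) {v : V}
    (hv : v ∈ nilVectors t V) (y : UniversalEnvelopingAlgebra ℂ g) : y • v ∈ nilVectors t V := by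
  obtain ⟨a, ha, rfl⟩ := mem_shift_iff.1 ht
  exact smul_mem_nilVectors_tw _ (h.mem_nilVectors_ad ha) hv y

theorem isProjectiveGenerator [FiniteDimensional ℂ g] (h : GoodData B f q Γ m) :
    IsProjectiveGenerator (shift (B f) m) := by
  obtain ⟨k, x, z, n, hA⟩ := h.exists_isAdapted
  refine ⟨fun t ht v => ?_, fun V _ _ hV K v hv => ?_, fun V _ _ hV hw v => ?_⟩
  · obtain ⟨X, rfl⟩ := Submodule.Quotient.mk_surjective _ v
    rw [← mul_one X, ← smul_eq_mul, Submodule.Quotient.mk_smul]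
    exact h.smul_mem_nilVectors ht ⟨1, by rw [pow_one]; exact one_mem_whi t ht⟩ X
  all_goals
    -- The filtration argument works with complex subspaces, so the scalars of `U(g)` are made to
    -- act.
    let _ : Module ℂ V := Module.compHom V (algebraMap ℂ (UniversalEnvelopingAlgebra ℂ g))
    have : IsScalarTower ℂ (UniversalEnvelopingAlgebra ℂ g) V :=
      ⟨fun c y v => by rw [Algebra.smul_def, mul_smul]; rfl⟩
    have hV' (a : g) (ha : a ∈ m) (v : V) : v ∈ nilVectors (tw (ιLin g) (B f) a) V :=
      hV _ (tw_mem_shift ha) v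
  · obtain ⟨w, hw, hvw⟩ := hA.exists_sub_eq_zero _ hV' K v fun i => hv _ (tw_mem_shift (hA.x_mem i))
    refine ⟨w, hw, fun t ht => ?_⟩
    obtain ⟨a, ha, rfl⟩ := mem_shift_iff.1 ht
    exact (Submodule.mem_bot ℂ).1
      (hA.tw_smul_mem _ ⊥ ha fun i => (Submodule.mem_bot ℂ).2 (hvw i))
  · by_contra hv
    obtain ⟨w, hw₀, hw₁⟩ := hA.exists_ne_zero _ hV' hv
    refine hw₀ (hw w fun t ht => ?_)
    obtain ⟨a, ha, rfl⟩ := mem_shift_iff.1 ht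
    exact hw₁ a ha

/-- `Γ 0` is orthogonal to the positive degrees, where `m` lives. -/
theorem char_eq_of_mem {f' : g} (h : GoodData B f q Γ m) (hf : f' - f ∈ Γ 0) {a : g}
    (ha : a ∈ m) : B f' a = B f a := by
  rw [← sub_eq_zero, ← LinearMap.sub_apply, ← map_sub]
  obtain ⟨s, hs, hs₁, -, -⟩ := h.good.exists_span
  rw [← LieSubalgebra.mem_toSubmodule, ← hs] at ha
  induction ha using Submodule.span_induction with
  | zero => exact map_zero _
  | add x y _ _ hx hy => rw [map_add, hx, hy, add_zero]
  | smul c x _ hx => rw [map_smul, hx, smul_zero]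
  | mem a ha =>
    obtain ⟨i, hi, hai⟩ := hs₁ a ha
    exact bilin_eq_zero_of_grade h.invariant h.element (by omega) hf hai

variable {f₁ f₂ q₁ q₂ : g} {Γ₁ Γ₂ : ℤ → Submodule ℂ g} {m₁ m₂ m₀ : LieSubalgebra ℂ g}

/-- The bracket `[a, y]` lies in the ideal `m₁`, where `χ₁ = χ₂`, and `χ₂` kills brackets of `m₂`.
So `[a, y] = [a, y] - χ₁([a, y])` is one of the generators of the left ideal. -/
theorem ι_mem_normalizer (h₁ : GoodData B f₁ q₁ Γ₁ m₁) (h₂ : GoodData B f₂ q₂ Γ₂ m₂)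
    (hsum : m₁.toSubmodule ⊔ m₀.toSubmodule = m₂.toSubmodule)
    (hideal : ∀ x ∈ m₂, ∀ y ∈ m₁, ⁅x, y⁆ ∈ m₁) (hf : f₂ - f₁ ∈ Γ₁ 0) {y : g} (hy : y ∈ m₀) :
    UniversalEnvelopingAlgebra.ι ℂ y ∈ normalizer ℂ (shift (B f₁) m₁) := by
  have hm₁ : m₁.toSubmodule ≤ m₂.toSubmodule := hsum ▸ le_sup_left
  have hm₀ : m₀.toSubmodule ≤ m₂.toSubmodule := hsum ▸ le_sup_right
  intro t ht
  obtain ⟨a, ha, rfl⟩ := mem_shift_iff.1 ht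
  have hay : ⁅a, y⁆ ∈ m₁ := by
    rw [← lie_skew]
    exact neg_mem (hideal y (hm₀ hy) a ha)
  rw [← ιLin_apply, lie_tw_ιLin]
  have e : tw (ιLin g) (B f₁) ⁅a, y⁆ = ιLin g ⁅a, y⁆ := by
    rw [tw_apply, ← h₁.char_eq_of_mem hf hay, h₂.char_lie (hm₁ ha) (hm₀ hy), map_zero, sub_zero]
  rw [← e]
  exact Ideal.subset_span (tw_mem_shift hay)

/-- As `χ₁ = χ₂` on `m₁`, a splitting `a = a₁ + a₀` in `m₂` splits the shifted element of `a`
accordingly. -/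
theorem isTwoStage [FiniteDimensional ℂ g] (h₁ : GoodData B f₁ q₁ Γ₁ m₁)
    (h₂ : GoodData B f₂ q₂ Γ₂ m₂) (hsum : m₁.toSubmodule ⊔ m₀.toSubmodule = m₂.toSubmodule)
    (hf : f₂ - f₁ ∈ Γ₁ 0)
    (hemb : ∀ y ∈ m₀, UniversalEnvelopingAlgebra.ι ℂ y ∈ normalizer ℂ (shift (B f₁) m₁)) :
    IsTwoStage (shift (B f₁) m₁) (shift (B f₂) m₂) (shift (B f₂) m₀)
      (shift₀ (B f₁) m₁ (B f₂) m₀ hemb) := by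
  have hm₁ : m₁.toSubmodule ≤ m₂.toSubmodule := hsum ▸ le_sup_left
  have hm₀ : m₀.toSubmodule ≤ m₂.toSubmodule := hsum ▸ le_sup_right
  have htw {a : g} (ha : a ∈ m₁) : tw (ιLin g) (B f₁) a = tw (ιLin g) (B f₂) a := by
    rw [tw_apply, tw_apply, h₁.char_eq_of_mem hf ha]
  have hn (y : UniversalEnvelopingAlgebra ℂ g) (hy : y ∈ shift (B f₂) m₀) :
      y ∈ normalizer ℂ (shift (B f₁) m₁) := by
    obtain ⟨a, ha, rfl⟩ := mem_shift_iff.1 hy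
    rw [tw_apply]
    exact sub_mem (hemb a ha) (algebraMap_mem _ _)
  refine ⟨h₁.isProjectiveGenerator, h₂.isProjectiveGenerator,
    fun V _ _ t ht v hv y => h₂.smul_mem_nilVectors ht hv y, fun t ht => ?_, fun t ht => ?_, hn,
    fun t ht => ?_, fun x => ⟨?_, ?_⟩⟩
  · obtain ⟨a, ha, rfl⟩ := mem_shift_iff.1 ht
    rw [htw ha]
    exact tw_mem_shift (hm₁ ha)
  · obtain ⟨a, ha, rfl⟩ := mem_shift_iff.1 ht
    exact tw_mem_shift (hm₀ ha)
  · obtain ⟨a, ha, rfl⟩ := mem_shift_iff.1 ht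
    rw [← LieSubalgebra.mem_toSubmodule, ← hsum] at ha
    obtain ⟨a₁, ha₁, a₀, ha₀, rfl⟩ := Submodule.mem_sup.1 ha
    exact ⟨_, tw_mem_shift ha₁, _, tw_mem_shift ha₀, by rw [map_add, htw ha₁]⟩
  · rintro ⟨y, rfl⟩
    exact ⟨_, tw_mem_shift y.2, rfl⟩
  · rintro ⟨y, hy, rfl⟩
    obtain ⟨a, ha, rfl⟩ := mem_shift_iff.1 hy
    exact ⟨⟨a, ha⟩, rfl⟩

end GoodData

end GoodGrading

end Stages

end

theorem theorem4p2 {g : Type u} [LieRing g] [LieAlgebra ℂ g] [FiniteDimensional ℂ g]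
    [LieAlgebra.IsSimple ℂ g]
    (B : LinearMap.BilinForm ℂ g) (hBsymm : B.IsSymm) (hBinv : B.lieInvariant g)
    (hBnondeg : B.Nondegenerate)
    (f₁ f₂ : g) (hf₁ : IsNilpotent (LieAlgebra.ad ℂ g f₁))
    (hf₂ : IsNilpotent (LieAlgebra.ad ℂ g f₂))
    (Γ₁ Γ₂ : ℤ → Submodule ℂ g)
    (hΓ₁ : Stages.IsGoodGrading Γ₁ f₁) (hΓ₂ : Stages.IsGoodGrading Γ₂ f₂)
    (q₁ q₂ : g)
    (hq₁ : Stages.IsGradingElement q₁ Γ₁) (hq₂ : Stages.IsGradingElement q₂ Γ₂)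
    (H : LieSubalgebra ℂ g) (hH : H.IsCartanSubalgebra) (hq₁H : q₁ ∈ H) (hq₂H : q₂ ∈ H)
    (m₁ m₂ m₀ : LieSubalgebra ℂ g)
    (hm₁ : Stages.IsGoodAlgebra Γ₁ (B f₁) m₁) (hm₂ : Stages.IsGoodAlgebra Γ₂ (B f₂) m₂)
    (hsum : m₁.toSubmodule ⊔ m₀.toSubmodule = m₂.toSubmodule)
    (hdisj : Disjoint m₁.toSubmodule m₀.toSubmodule)
    (hm₀H : ∀ x ∈ H, ∀ y ∈ m₀, ⁅x, y⁆ ∈ m₀)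
    (hideal : ∀ x ∈ m₂, ∀ y ∈ m₁, ⁅x, y⁆ ∈ m₁)
    (hf₀ : f₂ - f₁ ∈ Γ₁ 0) (hm₀ : m₀.toSubmodule ≤ Γ₁ 0)
    (hq₀ : ⁅q₂ - q₁, f₁⁆ = 0) :
    -- `m₀` maps to `U(g, f₁)` by `y ↦ y mod Î₁`, and `Ψ` identifies `U₀` with `U(g, f₂)` by
    -- `(X mod Î₁) mod Î₀ ↦ X mod Î₂`
    ∃ (hemb : ∀ y ∈ m₀, UniversalEnvelopingAlgebra.ι ℂ y ∈
          Stages.normalizer ℂ (Stages.shift (B f₁) m₁))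
      (Ψ : Stages.Reduction ℂ (Stages.shift₀ (B f₁) m₁ (B f₂) m₀ hemb) ≃ₐ[ℂ]
          Stages.FiniteW (B f₂) m₂),
      (∀ (X : UniversalEnvelopingAlgebra ℂ g)
          (h₁ : X ∈ Stages.normalizer ℂ (Stages.shift (B f₁) m₁))
          (h₀ : Stages.cls ℂ (Stages.shift (B f₁) m₁) X h₁ ∈
            Stages.normalizer ℂ (Stages.shift₀ (B f₁) m₁ (B f₂) m₀ hemb)),
        ∃ h₂ : X ∈ Stages.normalizer ℂ (Stages.shift (B f₂) m₂),
          Ψ (Stages.cls ℂ (Stages.shift₀ (B f₁) m₁ (B f₂) m₀ hemb)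
              (Stages.cls ℂ (Stages.shift (B f₁) m₁) X h₁) h₀) =
            Stages.cls ℂ (Stages.shift (B f₂) m₂) X h₂) ∧
      -- `Whi₀` and `Ind₀` are mutually inverse equivalences between `W₀` and `U(g, f₂)`-mod
      Stages.RestrictToEquivalence
        (Stages.WhiVia (Stages.shift₀ (B f₁) m₁ (B f₂) m₀ hemb) Ψ)
        (Stages.IndVia (Stages.shift₀ (B f₁) m₁ (B f₂) m₀ hemb) Ψ)
        (Stages.whittaker (Stages.shift₀ (B f₁) m₁ (B f₂) m₀ hemb))
        (Stages.finitelyGenerated (Stages.FiniteW (B f₂) m₂)) ∧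
      -- `W(g, f₂, m₂)` is contained in `W(g, f₁, m₁)`, and `Whi₁` and `Ind₁` restrict to
      -- mutually inverse equivalences between `W(g, f₂, m₂)` and `W₀`
      Stages.WhittakerModules (B f₂) m₂ ≤ Stages.WhittakerModules (B f₁) m₁ ∧
      Stages.RestrictToEquivalence
        (Stages.Whi ℂ (Stages.shift (B f₁) m₁))
        (Stages.Ind ℂ (Stages.shift (B f₁) m₁))
        (Stages.WhittakerModules (B f₂) m₂)
        (Stages.whittaker (Stages.shift₀ (B f₁) m₁ (B f₂) m₀ hemb)) ∧
      -- `Whi₂ = Whi₀ ∘ Whi₁` on `W(g, f₂, m₂)`: a natural isomorphism of `U(g, f₂)`-modules which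
      -- is the identity on the underlying vectors of `V`
      ∃ α : (Stages.WhittakerModules (B f₂) m₂).ι ⋙ Stages.Whi ℂ (Stages.shift (B f₁) m₁) ⋙
            Stages.WhiVia (Stages.shift₀ (B f₁) m₁ (B f₂) m₀ hemb) Ψ ≅
          (Stages.WhittakerModules (B f₂) m₂).ι ⋙ Stages.Whi ℂ (Stages.shift (B f₂) m₂),
        ∀ (V : (Stages.WhittakerModules (B f₂) m₂).FullSubcategory)
          (v : Stages.whi (Stages.shift₀ (B f₁) m₁ (B f₂) m₀ hemb)
            (Stages.whi (Stages.shift (B f₁) m₁) V.obj)),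
          (Stages.whi (Stages.shift (B f₂) m₂) V.obj).subtype ((α.hom.app V).hom v) =
            ((v : Stages.whi (Stages.shift (B f₁) m₁) V.obj) : V.obj) := by
  have h₁ : Stages.GoodData B f₁ q₁ Γ₁ m₁ := ⟨hBinv, hBnondeg, hBsymm, hΓ₁, hq₁, hm₁⟩
  have h₂ : Stages.GoodData B f₂ q₂ Γ₂ m₂ := ⟨hBinv, hBnondeg, hBsymm, hΓ₂, hq₂, hm₂⟩
  have hemb := fun y (hy : y ∈ m₀) => h₁.ι_mem_normalizer h₂ hsum hideal hf₀ hy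
  have h := h₁.isTwoStage h₂ hsum hf₀ hemb
  exact ⟨hemb, h.reductionEquiv,
    fun X k₁ k₀ => ⟨h.mem_normalizer₂ k₁ k₀, h.reductionEquiv_cls k₁ k₀⟩,
    h.gen₀.restrictToEquivalence_via h.reductionEquiv, h.whittaker_le, h.restrictToEquivalence₁,
    h.whiWhiIso, h.whiWhiIso_apply⟩
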